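/- Let $N,p,q,\sigma\in\mathbb R$ with $q>p-1>0$ and $p>N>-\sigma$. For $\varepsilon\in\{1,-1\}$ consider the positive solutions of $$-(|w'|^{p-2}w')'-\frac{N-1}{r}|w'|^{p-2}w'=\varepsilon r^{\sigma}w^{q}, \qquad (E_\varepsilon)$$ where a positive solution on an open interval $I\subset(0,\infty)$ is a function $w>0$ on $I$ such that $w$ and $|w'|^{p-2}w'$ are differentiable and $(E_\varepsilon)$ holds on $I$. A solution on $(0,\rho)$, $0<\rho\le\infty$, is called $C^0$-regular if it is $C^2$ on $(0,\rho)$ and has a finite limit at $0$. Put $\gamma=\frac{p+\sigma}{q+1-p}$ and $w^*(r)=a^*r^{-\gamma}$, where $a^*>0$ and $(a^*)^{q-p+1}=-|\gamma|^{p-2}\gamma\,(N-p-(p-1)\gamma)$. (1) There are functions $c_1,c_2:(0,\infty)\to(0,\infty)$, depending only on $N,p,q,\sigma$, such that for $\varepsilon=1$ and for $\varepsilon=-1$ there exist local $C^0$-regular solutions near $0$ of the following three types: for every $w_0>0$ one with $$\lim_{r\to0}w=w_0,\qquad \lim_{r\to0}r^{-\frac{\sigma+1}{p-1}}w'=-\varepsilon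 c_1(w_0);$$ for every $k>0$ one with $$\lim_{r\to0}w=0,\qquad \lim_{r\to0}r^{\frac{N-p}{p-1}}w=k,\qquad \lim_{r\to0}r^{\frac{N-1}{p-1}}w'=c_2(k);$$ for every $w_0>0$ and every $d\neq0$ one with $$\lim_{r\to0}w=w_0,\qquad \lim_{r\to0}r^{\frac{N-1}{p-1}}w'=d .$$ Every $C^0$-regular solution on an interval $(0,\rho)$ is of one of these three types. (2) If $\varepsilon=1$, there is no positive solution on $(r_0,\infty)$ for any $r_0\ge0$; in particular no solution is global on $(0,\infty)$. (3) If $\varepsilon=-1$, then $w^*$ is a positive solution on $(0,\infty)$, and there is a function $c:(0,\infty)\to(0,\infty)$, depending only on $N,p,q,\sigma$, such that for every $w_0>0$ there is a $C^0$-regular positive solution on $(0,\infty)$ with $$\lim_{r\to0}w=w_0,\qquad \lim_{r\to0}r^{\frac{N-1}{p-1}}w'=-c(w_0),\qquad \lim_{r\to\infty}\frac{w}{w^*}=1 .$$ Every positive solution on $(0,\infty)$ is either $w^*$ or has these three properties for some $w_0>0$. -/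

import Mathlib

open Set Filter Topology Asymptotics

noncomputable section

namespace HardyHenon

/-- The one-dimensional flux `|w'|^(p-2) w'`. It is `0` wherever `w' = 0`. -/
def flux (p : ℝ) (w : ℝ → ℝ) (r : ℝ) : ℝ :=
  |deriv w r| ^ (p - 2) * deriv w r

/-- `w` is a positive solution on the open set `I` of radii of
`-(|w'|^(p-2) w')' - ((N-1)/r) |w'|^(p-2) w' = ε r^σ w^q`.
Both `w` and its flux are differentiable (hence, by the equation, `w` and the flux are `C^1`). -/
structure IsPositiveSolution (N p q σ ε : ℝ) (I : Set ℝ) (w : ℝ → ℝ) : Prop where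
  pos : ∀ r ∈ I, 0 < w r
  differentiableAt : ∀ r ∈ I, DifferentiableAt ℝ w r
  differentiableAt_flux : ∀ r ∈ I, DifferentiableAt ℝ (flux p w) r
  equation : ∀ r ∈ I,
    -deriv (flux p w) r - (N - 1) / r * flux p w r = ε * r ^ σ * w r ^ q

/-- `C^0`-regular positive solutions on an interval `I = (0, ρ)` or `I = (0, ∞)`:
`w` is `C^2` on `I` and has a finite (nonnegative) limit at `0`. -/
structure IsC0Regular (N p q σ ε : ℝ) (I : Set ℝ) (w : ℝ → ℝ) : Prop where
  isPositiveSolution : IsPositiveSolution N p q σ ε I w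
  contDiffOn : ContDiffOn ℝ 2 w I
  exists_limit : ∃ c : ℝ, 0 ≤ c ∧ Tendsto w (𝓝[>] 0) (𝓝 c)

/-- The exponent `γ = (p + σ) / (q + 1 - p)`. -/
def gammaExp (p q σ : ℝ) : ℝ := (p + σ) / (q + 1 - p)

/-- The constant `a*`, given by `a*^(q-p+1) = ε |γ|^(p-2) γ (N - p - (p-1) γ)`. -/
def aStar (N p q σ ε : ℝ) : ℝ :=
  (ε * |gammaExp p q σ| ^ (p - 2) * gammaExp p q σ *
    (N - p - (p - 1) * gammaExp p q σ)) ^ (1 / (q - p + 1))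

/-- The particular solution `w*(r) = a* r^(-γ)`. -/
def wStar (N p q σ ε : ℝ) (r : ℝ) : ℝ :=
  aStar N p q σ ε * r ^ (-gammaExp p q σ)

/-- First behaviour at `0`: `w → w₀` and `r^(-(σ+1)/(p-1)) w' → m`. -/
def RegularAtZero (p σ w₀ m : ℝ) (w : ℝ → ℝ) : Prop :=
  Tendsto w (𝓝[>] 0) (𝓝 w₀) ∧
  Tendsto (fun r : ℝ => r ^ (-((σ + 1) / (p - 1))) * deriv w r) (𝓝[>] 0) (𝓝 m)

/-- Second behaviour at `0`: `w → 0`, `r^((N-p)/(p-1)) w → k` and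
`r^((N-1)/(p-1)) w' → m`. -/
def VanishingAtZero (N p k m : ℝ) (w : ℝ → ℝ) : Prop :=
  Tendsto w (𝓝[>] 0) (𝓝 0) ∧
  Tendsto (fun r : ℝ => r ^ ((N - p) / (p - 1)) * w r) (𝓝[>] 0) (𝓝 k) ∧
  Tendsto (fun r : ℝ => r ^ ((N - 1) / (p - 1)) * deriv w r) (𝓝[>] 0) (𝓝 m)

/-- Third behaviour at `0`: `w → w₀` and `r^((N-1)/(p-1)) w' → d`. -/
def FluxAtZero (N p w₀ d : ℝ) (w : ℝ → ℝ) : Prop :=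
  Tendsto w (𝓝[>] 0) (𝓝 w₀) ∧
  Tendsto (fun r : ℝ => r ^ ((N - 1) / (p - 1)) * deriv w r) (𝓝[>] 0) (𝓝 d)

end HardyHenon

end

/-! With `F = r^(N-1) |w'|^(p-2) w'`, `θ = (p-N)/(p-1)`, `τ = N+σ` and `m = 1/(p-1)` the equation
becomes `w' = r^(θ-1) |F|^(m-1) F`, `F' = -ε r^(τ-1) w^q`. The hypotheses say exactly that `θ, τ, m
> 0` and `m q > 1`.

Near `0` both weights are integrable, so `F` has a limit as soon as `w` has one, and the three types
are `F₀ = 0`, `w₀ = 0`, and neither. Both limits cannot vanish, because the system is superlinear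
(`IsFluxSystem.flux_limit_pos`). Each type is produced by a contraction on the integral equations
(`exists_local_solution`).

For `ε = 1` the flux decreases. Once negative it drives `w` below `0` like `-r^θ`; if it stays
positive, `w` increases and `F` falls like `-r^τ`. Either way a solution near infinity is
contradictory.

For `ε = -1` a flux that is nonnegative somewhere makes `w F` blow up at a finite radius, so global
solutions have `F < 0` (`IsFluxSystem.flux_neg`). Writing `w = a r^(-γ) x(log r)` and `-F = b r^(-δ)
y(log r)` gives the autonomous system `x' = γ(x - y^m)`, `y' = δ(y - x^q)`, whose only positive
equilibrium `(1,1)` is `w*`. The signs of the defects `x - y^m` and `y - x^q` decide everything.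
Opposite signs persist forward and push a component below `0`; two negative signs give blow-up of `x
y` backward in time (`IsOrbit.not_both_decreasing`). Hence every other orbit increases from `(0,0)`
to `(1,1)` (`IsOrbit.dichotomy`), and near `-∞` it satisfies `x ~ u₀ e^(γ t)`, which is the positive
limit of `w` at `0` (`IsOrbit.exists_limit_exp_mul`).

A nonconstant orbit is found by monotone iteration between explicit profiles
(`exists_orbit_of_ordered`), and a time shift prescribes `w₀`. Finally, two global solutions with
the same `w₀` have the same limit of `F` at `0`, by a cooperative comparison
(`IsFluxSystem.flux_limit_le`); this makes `c(w₀)` well defined. -/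

namespace HardyHenon

/-! ### Reduction to a first order system for `w` and its weighted flux. -/

/-- The signed power `|x|^(m-1) x`. -/
noncomputable def spow (m x : ℝ) : ℝ := |x| ^ (m - 1) * x

lemma spow_of_pos {m x : ℝ} (hx : 0 < x) : spow m x = x ^ m := by
  rw [spow, abs_of_pos hx, Real.rpow_sub_one hx.ne', div_mul_cancel₀ _ hx.ne']

lemma spow_neg (m x : ℝ) : spow m (-x) = -spow m x := by
  simp [spow]

lemma spow_zero (m : ℝ) : spow m 0 = 0 := by simp [spow]

lemma spow_of_neg {m x : ℝ} (hx : x < 0) : spow m x = -(-x) ^ m := by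
  rw [← spow_of_pos (neg_pos.2 hx), spow_neg, neg_neg]

lemma spow_spow {m k : ℝ} (h : k * m = 1) (x : ℝ) : spow m (spow k x) = x := by
  have key : ∀ x : ℝ, 0 < x → spow m (spow k x) = x := fun x hx => by
    rw [spow_of_pos hx, spow_of_pos (Real.rpow_pos_of_pos hx _), ← Real.rpow_mul hx.le, h,
      Real.rpow_one]
  rcases lt_trichotomy x 0 with hx | rfl | hx
  · have := key (-x) (neg_pos.2 hx)
    rw [spow_neg, spow_neg] at this
    linarith
  · simp [spow_zero]
  · exact key x hx

lemma spow_mul_of_pos {m c : ℝ} (hc : 0 < c) (x : ℝ) : spow m (c * x) = c ^ m * spow m x := by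
  rw [spow, spow, abs_mul, abs_of_pos hc, Real.mul_rpow hc.le (abs_nonneg _),
    Real.rpow_sub_one hc.ne']
  field_simp

lemma spow_ne_zero {m x : ℝ} (hx : x ≠ 0) : spow m x ≠ 0 :=
  mul_ne_zero (Real.rpow_pos_of_pos (abs_pos.2 hx) _).ne' hx

lemma continuous_spow {m : ℝ} (hm : 0 < m) : Continuous (spow m) := by
  have : spow m = fun x => (max x 0) ^ m - (max (-x) 0) ^ m := by
    ext x
    rcases lt_trichotomy x 0 with hx | rfl | hx
    · rw [spow_of_neg hx, max_eq_right hx.le, max_eq_left (by linarith), Real.zero_rpow hm.ne',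
        zero_sub]
    · simp [spow_zero]
    · rw [spow_of_pos hx, max_eq_left hx.le, max_eq_right (by linarith), Real.zero_rpow hm.ne',
        sub_zero]
  rw [this]
  exact ((continuous_id.max continuous_const).rpow_const fun _ => Or.inr hm.le).sub
    ((continuous_neg.max continuous_const).rpow_const fun _ => Or.inr hm.le)

/-- The first order system `w' = r^(θ-1) |F|^(m-1) F`, `F' = -ε r^(τ-1) w^q` with `w > 0`. -/
def IsFluxSystem (θ τ m q ε : ℝ) (I : Set ℝ) (w F : ℝ → ℝ) : Prop :=
  ∀ r ∈ I, 0 < w r ∧ HasDerivAt w (r ^ (θ - 1) * spow m (F r)) r ∧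
    HasDerivAt F (-ε * r ^ (τ - 1) * w r ^ q) r

lemma flux_eq_spow (p : ℝ) (w : ℝ → ℝ) (r : ℝ) : flux p w r = spow (p - 1) (deriv w r) := by
  rw [flux, spow]
  ring_nf

/-- Multiplying by `r^(N-1)` puts the equation in divergence form. The two weights in `w'` cancel
because `(θ-1) + (N-1)/(p-1) = 0`. -/
lemma IsPositiveSolution.isFluxSystem {N p q σ ε : ℝ} {I : Set ℝ} {w : ℝ → ℝ} (hp : 1 < p)
    (hI : I ⊆ Ioi 0) (h : IsPositiveSolution N p q σ ε I w) :
    IsFluxSystem ((p - N) / (p - 1)) (N + σ) (1 / (p - 1)) q ε I w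
      (fun r => r ^ (N - 1) * flux p w r) := by
  intro r hr
  have hr0 : 0 < r := hI hr
  have hp1 : p - 1 ≠ 0 := by linarith
  refine ⟨h.pos r hr, ?_, ?_⟩
  · have h1 := (h.differentiableAt r hr).hasDerivAt
    refine h1.congr_deriv ?_
    symm
    rw [spow_mul_of_pos (Real.rpow_pos_of_pos hr0 _), flux_eq_spow,
      spow_spow (mul_one_div_cancel hp1), ← Real.rpow_mul hr0.le, ← mul_assoc,
      ← Real.rpow_add hr0]
    have : (p - N) / (p - 1) - 1 + (N - 1) * (1 / (p - 1)) = 0 := by field_simp; ring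
    rw [this, Real.rpow_zero, one_mul]
  · have h2 := (h.differentiableAt_flux r hr).hasDerivAt
    have h3 := (Real.hasDerivAt_rpow_const (p := N - 1) (Or.inl hr0.ne')).mul h2
    refine h3.congr_deriv ?_
    have h4 := h.equation r hr
    have h5 : deriv (flux p w) r = - ((N - 1) / r * flux p w r) - ε * r ^ σ * w r ^ q := by
      linarith
    rw [h5, Real.rpow_sub_one hr0.ne' (N - 1), show N + σ - 1 = (N - 1) + σ by ring,
      Real.rpow_add hr0]
    field_simp
    ring

lemma IsFluxSystem.flux_eq {N p q τ ε : ℝ} {I : Set ℝ} {w F : ℝ → ℝ} (hp : 1 < p)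
    (hI : I ⊆ Ioi 0) (h : IsFluxSystem ((p - N) / (p - 1)) τ (1 / (p - 1)) q ε I w F)
    {r : ℝ} (hr : r ∈ I) : flux p w r = r ^ (1 - N) * F r := by
  have hr0 : 0 < r := hI hr
  have hp1 : p - 1 ≠ 0 := by linarith
  rw [flux_eq_spow, (h r hr).2.1.deriv, spow_mul_of_pos (Real.rpow_pos_of_pos hr0 _),
    spow_spow (one_div_mul_cancel hp1), ← Real.rpow_mul hr0.le]
  congr 2
  field_simp
  ring

lemma IsFluxSystem.isPositiveSolution {N p q σ ε : ℝ} {I : Set ℝ} {w F : ℝ → ℝ} (hp : 1 < p)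
    (hI : I ⊆ Ioi 0) (hIo : IsOpen I)
    (h : IsFluxSystem ((p - N) / (p - 1)) (N + σ) (1 / (p - 1)) q ε I w F) :
    IsPositiveSolution N p q σ ε I w := by
  have key : ∀ r ∈ I, HasDerivAt (flux p w)
      ((1 - N) * r ^ (1 - N - 1) * F r + r ^ (1 - N) * (-ε * r ^ (N + σ - 1) * w r ^ q)) r := by
    intro r hr
    have hr0 : 0 < r := hI hr
    refine ((Real.hasDerivAt_rpow_const (p := 1 - N) (Or.inl hr0.ne')).mul
      (h r hr).2.2).congr_of_eventuallyEq ?_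
    filter_upwards [hIo.mem_nhds hr] with s hs
    exact h.flux_eq hp hI hs
  refine ⟨fun r hr => (h r hr).1, fun r hr => (h r hr).2.1.differentiableAt,
    fun r hr => (key r hr).differentiableAt, fun r hr => ?_⟩
  have hr0 : 0 < r := hI hr
  rw [(key r hr).deriv, h.flux_eq hp hI hr, Real.rpow_sub_one hr0.ne']
  have : r ^ σ = r ^ (1 - N) * r ^ (N + σ - 1) := by
    rw [← Real.rpow_add hr0]; ring_nf
  rw [this]
  field_simp
  ring

/-- A solution whose flux never vanishes is of class `C^2`. -/
lemma IsFluxSystem.contDiffOn {θ τ m q ε : ℝ} {I : Set ℝ} {w F : ℝ → ℝ}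
    (hI : I ⊆ Ioi 0) (hIo : IsOpen I) (h : IsFluxSystem θ τ m q ε I w F)
    (hF : ∀ r ∈ I, F r ≠ 0) : ContDiffOn ℝ 2 w I := by
  have hid : ∀ α : ℝ, ContDiffOn ℝ 1 (fun r : ℝ => r ^ α) I := fun α =>
    contDiffOn_id.rpow_const_of_ne fun r hr => (hI hr).ne'
  have hwd : DifferentiableOn ℝ w I := fun r hr => (h r hr).2.1.differentiableAt.differentiableWithinAt
  have hFd : DifferentiableOn ℝ F I := fun r hr => (h r hr).2.2.differentiableAt.differentiableWithinAt
  have hF1 : ContDiffOn ℝ 1 F I := by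
    rw [show (1 : WithTop ℕ∞) = 0 + 1 by norm_num, contDiffOn_succ_iff_deriv_of_isOpen hIo]
    refine ⟨hFd, by simp, contDiffOn_zero.2 ?_⟩
    refine ContinuousOn.congr (f := fun r => -ε * r ^ (τ - 1) * w r ^ q) ?_
      fun r hr => (h r hr).2.2.deriv
    exact (continuousOn_const.mul (hid _).continuousOn).mul
      (hwd.continuousOn.rpow_const fun r hr => Or.inl (h r hr).1.ne')
  rw [show (2 : WithTop ℕ∞) = 1 + 1 by norm_num, contDiffOn_succ_iff_deriv_of_isOpen hIo]
  refine ⟨hwd, by simp, ?_⟩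
  refine ContDiffOn.congr (f := fun r => r ^ (θ - 1) * spow m (F r)) ?_
    fun r hr => (h r hr).2.1.deriv
  refine (hid _).mul ?_
  have habs : ContDiffOn ℝ 1 (fun r => |F r|) I := by
    intro r hr
    exact (hF1 r hr).abs (hF r hr)
  exact (habs.rpow_const_of_ne fun r hr => (abs_pos.2 (hF r hr)).ne').mul hF1

/-! ### Nonexistence near infinity for `ε = 1`. -/

lemma hasDerivAt_rpow_div {α r : ℝ} (hα : α ≠ 0) (hr : 0 < r) :
    HasDerivAt (fun r : ℝ => r ^ α / α) (r ^ (α - 1)) r := by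
  have := (Real.hasDerivAt_rpow_const (p := α) (Or.inl hr.ne')).div_const α
  refine this.congr_deriv ?_
  field_simp

lemma antitoneOn_Ici_of_hasDerivAt {g g' : ℝ → ℝ} {a : ℝ}
    (hg : ∀ r, a ≤ r → HasDerivAt g (g' r) r) (hg' : ∀ r, a ≤ r → g' r ≤ 0) :
    AntitoneOn g (Ici a) := by
  refine antitoneOn_of_deriv_nonpos (convex_Ici a)
    (fun r hr => (hg r hr).continuousAt.continuousWithinAt)
    (fun r hr => (hg r (interior_subset hr)).differentiableAt.differentiableWithinAt) ?_
  intro r hr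
  rw [(hg r (interior_subset hr)).deriv]
  exact hg' r (interior_subset hr)

/-- A function with slope at most `-c r^(α-1)` becomes negative. -/
lemma exists_neg_of_deriv_le {g g' : ℝ → ℝ} {a c α : ℝ} (ha : 0 < a) (hc : 0 < c) (hα : 0 < α)
    (hg : ∀ r, a ≤ r → HasDerivAt g (g' r) r)
    (hg' : ∀ r, a ≤ r → g' r ≤ -(c * r ^ (α - 1))) : ∃ r, a ≤ r ∧ g r < 0 := by
  have hanti : AntitoneOn (fun r => g r + c * (r ^ α / α)) (Ici a) :=
    antitoneOn_Ici_of_hasDerivAt (g' := fun r => g' r + c * r ^ (α - 1))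
      (fun r hr => (hg r hr).add ((hasDerivAt_rpow_div hα.ne' (ha.trans_le hr)).const_mul c))
      (fun r hr => by linarith [hg' r hr])
  have hlim : Tendsto (fun r : ℝ => c * (r ^ α / α)) atTop atTop :=
    ((tendsto_rpow_atTop hα).atTop_div_const hα).const_mul_atTop hc
  obtain ⟨r, hr1, hr2⟩ := ((hlim.eventually_gt_atTop (g a + c * (a ^ α / α))).and
    (eventually_ge_atTop a)).exists
  exact ⟨r, hr2, by have := hanti (self_mem_Ici) hr2 hr2; simp only at this; linarith⟩

lemma IsFluxSystem.mono {θ τ m q ε : ℝ} {I J : Set ℝ} {w F : ℝ → ℝ}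
    (h : IsFluxSystem θ τ m q ε I w F) (hJ : J ⊆ I) : IsFluxSystem θ τ m q ε J w F :=
  fun r hr => h r (hJ hr)

/-- A flux bounded above by a negative constant forces `w` to vanish. -/
lemma IsFluxSystem.exists_flux_gt {θ τ m q ε r₀ c : ℝ} {w F : ℝ → ℝ} (hθ : 0 < θ)
    (hr₀ : 0 < r₀) (hc : 0 < c) (hm : 0 < m)
    (h : IsFluxSystem θ τ m q ε (Ici r₀) w F) : ∃ r, r₀ ≤ r ∧ -c < F r := by
  by_contra! hcon
  obtain ⟨r, hr, hneg⟩ := exists_neg_of_deriv_le (c := c ^ m) hr₀ (Real.rpow_pos_of_pos hc _) hθ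
    (fun r hr => (h r hr).2.1) (fun r hr => by
      have h1 : F r ≤ -c := hcon r hr
      have h0 : 0 < r := hr₀.trans_le hr
      rw [spow_of_neg (by linarith)]
      have h2 : c ^ m ≤ (-F r) ^ m := Real.rpow_le_rpow hc.le (by linarith) hm.le
      have h3 := Real.rpow_pos_of_pos h0 (θ - 1)
      nlinarith)
  exact absurd (h r hr).1 (by linarith)

/-- There is no positive solution near infinity when `ε = 1`. -/
theorem IsFluxSystem.not_exterior {θ τ m q r₀ : ℝ} {w F : ℝ → ℝ} (hθ : 0 < θ) (hτ : 0 < τ)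
    (hm : 0 < m) (hq : 0 < q) (hr₀ : 0 ≤ r₀)
    (h : IsFluxSystem θ τ m q 1 (Ioi r₀) w F) : False := by
  have hsub : ∀ {a : ℝ}, r₀ < a → Ici a ⊆ Ioi r₀ := fun ha x hx => ha.trans_le hx
  have hFanti : ∀ a, r₀ < a → StrictAntiOn F (Ici a) := fun a ha => by
    refine strictAntiOn_of_deriv_neg (convex_Ici a)
      (fun r hr => (h r (hsub ha hr)).2.2.continuousAt.continuousWithinAt) fun r hr => ?_
    have hr' := hsub ha (interior_subset hr)
    have hr0 : 0 < r := hr₀.trans_lt hr'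
    rw [(h r hr').2.2.deriv]
    have := mul_pos (Real.rpow_pos_of_pos hr0 (τ - 1)) (Real.rpow_pos_of_pos (h r hr').1 q)
    linarith
  have hFpos : ∀ r, r₀ < r → 0 < F r := by
    intro r hr
    -- If `F r ≤ 0`, strict decrease makes `F` at most the negative constant `F (r + 1)` from then
    -- on, which `exists_flux_gt` forbids.
    by_contra! hle
    have h1 : F (r + 1) < F r := hFanti r hr self_mem_Ici (by simp) (by linarith)
    have hr1 : r₀ < r + 1 := by linarith
    obtain ⟨s, hs, hFs⟩ := (h.mono (hsub hr1)).exists_flux_gt (c := -F (r + 1)) hθ (by linarith)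
      (by linarith) hm
    have := (hFanti _ hr1).antitoneOn self_mem_Ici hs hs
    linarith
  have ha : r₀ < r₀ + 1 := by linarith
  have hwmono : MonotoneOn w (Ici (r₀ + 1)) := by
    refine monotoneOn_of_deriv_nonneg (convex_Ici _)
      (fun r hr => (h r (hsub ha hr)).2.1.continuousAt.continuousWithinAt)
      (fun r hr => (h r (hsub ha (interior_subset hr))).2.1.differentiableAt.differentiableWithinAt)
      fun r hr => ?_
    have hr' := hsub ha (interior_subset hr)
    rw [(h r hr').2.1.deriv, spow_of_pos (hFpos r hr')]
    have hr0 : 0 < r := hr₀.trans_lt hr'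
    have := hFpos r hr'
    positivity
  -- Since `w` increases, `F' ≤ -w(r₀+1)^q r^(τ-1)`, so `F` becomes negative after all.
  obtain ⟨r, hr, hneg⟩ := exists_neg_of_deriv_le (a := r₀ + 1) (c := w (r₀ + 1) ^ q)
    (by linarith) (Real.rpow_pos_of_pos (h _ ha).1 _) hτ (fun r hr => (h r (hsub ha hr)).2.2)
    (fun r hr => by
      have h2 : w (r₀ + 1) ^ q ≤ w r ^ q :=
        Real.rpow_le_rpow (h _ ha).1.le (hwmono self_mem_Ici hr hr) hq.le
      have h3 := Real.rpow_pos_of_pos (show (0:ℝ) < r by linarith) (τ - 1)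
      nlinarith)
  exact absurd (hFpos r (hsub ha hr)) (by linarith)

/-! ### Limits and asymptotics at the origin. -/

lemma Ioo_mem_nhdsGT_zero {ρ : ℝ} (hρ : 0 < ρ) : Ioo 0 ρ ∈ 𝓝[>] (0 : ℝ) := Ioo_mem_nhdsGT hρ

lemma antitoneOn_Ioc_of_hasDerivAt {g g' : ℝ → ℝ} {r : ℝ}
    (hg : ∀ s, 0 < s → s ≤ r → HasDerivAt g (g' s) s) (hg' : ∀ s, 0 < s → s ≤ r → g' s ≤ 0) :
    AntitoneOn g (Ioc 0 r) := by
  refine antitoneOn_of_deriv_nonpos (convex_Ioc 0 r)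
    (fun s hs => (hg s hs.1 hs.2).continuousAt.continuousWithinAt)
    (fun s hs => (hg s (interior_subset hs).1
      (interior_subset hs).2).differentiableAt.differentiableWithinAt) ?_
  intro s hs
  rw [(hg s (interior_subset hs).1 (interior_subset hs).2).deriv]
  exact hg' s (interior_subset hs).1 (interior_subset hs).2

/-- A function which is nonincreasing on `(0, r]` lies below its limit at `0`. -/
lemma le_of_tendsto_of_deriv_nonpos {g g' : ℝ → ℝ} {r L : ℝ} (hr : 0 < r)
    (hg : ∀ s, 0 < s → s ≤ r → HasDerivAt g (g' s) s) (hg' : ∀ s, 0 < s → s ≤ r → g' s ≤ 0)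
    (hL : Tendsto g (𝓝[>] 0) (𝓝 L)) : g r ≤ L := by
  refine ge_of_tendsto hL ?_
  filter_upwards [Ioo_mem_nhdsGT_zero hr] with s hs
  exact antitoneOn_Ioc_of_hasDerivAt hg hg' ⟨hs.1, hs.2.le⟩ ⟨hr, le_rfl⟩ hs.2.le

lemma tendsto_rpow_nhdsGT_zero {α : ℝ} (hα : 0 < α) :
    Tendsto (fun r : ℝ => r ^ α) (𝓝[>] 0) (𝓝 0) := by
  have := (Real.continuousAt_rpow_const 0 α (Or.inr hα.le)).tendsto
  rw [Real.zero_rpow hα.ne'] at this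
  exact this.mono_left nhdsWithin_le_nhds

lemma spow_nonpos {m x : ℝ} (hx : x ≤ 0) : spow m x ≤ 0 :=
  mul_nonpos_of_nonneg_of_nonpos (Real.rpow_nonneg (abs_nonneg _) _) hx

section
variable {θ τ m q ε ρ c : ℝ} {w F : ℝ → ℝ}

/-- `ε F` is nonincreasing, and adding `(c+1)^q r^τ/τ` makes it nondecreasing near `0`, since `w < c
+ 1` there. Thus `ε F` is monotone and bounded as `r → 0`; integrability of `r^(τ-1)` is what
matters. -/
lemma IsFluxSystem.exists_flux_limit (hτ : 0 < τ) (hq : 0 < q) (hε : ε = 1 ∨ ε = -1) (hρ : 0 < ρ)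
    (h : IsFluxSystem θ τ m q ε (Ioo 0 ρ) w F) (hw : Tendsto w (𝓝[>] 0) (𝓝 c)) :
    ∃ F₀, Tendsto F (𝓝[>] 0) (𝓝 F₀) := by
  have hε2 : ε * ε = 1 := by rcases hε with rfl | rfl <;> norm_num
  obtain ⟨s, hs, hsw⟩ := (mem_nhdsGT_iff_exists_Ioo_subset).1
    (inter_mem (Ioo_mem_nhdsGT_zero hρ) (hw.eventually_lt_const (lt_add_one c)))
  have hs0 : 0 < s := hs
  set b := s / 2 with hb
  have hb0 : 0 < b := by positivity
  have hmem : ∀ r, 0 < r → r ≤ b → r ∈ Ioo 0 ρ ∧ w r < c + 1 := fun r h1 h2 =>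
    hsw ⟨h1, by linarith⟩
  have hG : ∀ r, 0 < r → r ≤ b → HasDerivAt (fun r => ε * F r) (-(r ^ (τ - 1) * w r ^ q)) r := by
    intro r h1 h2
    refine ((h r (hmem r h1 h2).1).2.2.const_mul ε).congr_deriv ?_
    linear_combination (-(r ^ (τ - 1) * w r ^ q)) * hε2
  have hanti : AntitoneOn (fun r => ε * F r) (Ioc 0 b) :=
    antitoneOn_Ioc_of_hasDerivAt hG fun r h1 h2 => by
      have := mul_pos (Real.rpow_pos_of_pos h1 (τ - 1))
        (Real.rpow_pos_of_pos (h r (hmem r h1 h2).1).1 q)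
      linarith
  have hmono : AntitoneOn (fun r => -(ε * F r) - (c + 1) ^ q * (r ^ τ / τ)) (Ioc 0 b) :=
    antitoneOn_Ioc_of_hasDerivAt (g' := fun r => -(-(r ^ (τ - 1) * w r ^ q))
        - (c + 1) ^ q * r ^ (τ - 1))
      (fun r h1 h2 => (hG r h1 h2).neg.sub ((hasDerivAt_rpow_div hτ.ne' h1).const_mul _))
      fun r h1 h2 => by
        have h3 : w r ^ q ≤ (c + 1) ^ q :=
          Real.rpow_le_rpow (h r (hmem r h1 h2).1).1.le (hmem r h1 h2).2.le hq.le
        have h4 := Real.rpow_pos_of_pos h1 (τ - 1)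
        nlinarith
  have hlim := (hanti.neg.mono Ioo_subset_Ioc_self).tendsto_nhdsWithin_Ioo_right
    (nonempty_Ioo.2 hb0) ⟨-(ε * F b) - (c + 1) ^ q * (b ^ τ / τ), by
      rintro _ ⟨r, hr, rfl⟩
      have h1 := hmono ⟨hr.1, hr.2.le⟩ ⟨hb0, le_rfl⟩ hr.2.le
      simp only at h1
      have hc : 0 < c + 1 :=
        (h b (hmem b hb0 le_rfl).1).1.trans (hmem b hb0 le_rfl).2
      have h2 : 0 ≤ (c + 1) ^ q * (r ^ τ / τ) := by have := hr.1; positivity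
      simp only
      linarith⟩
  refine ⟨_, (hlim.const_mul (-ε)).congr fun r => ?_⟩
  linear_combination F r * hε2

lemma IsFluxSystem.tendsto_deriv {F₀ : ℝ} (hm : 0 < m) (hρ : 0 < ρ)
    (h : IsFluxSystem θ τ m q ε (Ioo 0 ρ) w F) (hF : Tendsto F (𝓝[>] 0) (𝓝 F₀)) :
    Tendsto (fun r : ℝ => r ^ (1 - θ) * deriv w r) (𝓝[>] 0) (𝓝 (spow m F₀)) := by
  refine (((continuous_spow hm).tendsto F₀).comp hF).congr' ?_
  filter_upwards [Ioo_mem_nhdsGT_zero hρ] with r hr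
  rw [(h r hr).2.1.deriv, ← mul_assoc, ← Real.rpow_add hr.1]
  simp

/-- L'Hôpital's rule: when the flux vanishes at the origin, `F` behaves like `-ε c^q r^τ/τ`, which
fixes the rate of `w'` in the first type. -/
lemma IsFluxSystem.tendsto_flux_div (hτ : 0 < τ) (hq : 0 < q) (hρ : 0 < ρ)
    (h : IsFluxSystem θ τ m q ε (Ioo 0 ρ) w F) (hw : Tendsto w (𝓝[>] 0) (𝓝 c))
    (hF : Tendsto F (𝓝[>] 0) (𝓝 0)) :
    Tendsto (fun r => F r / (r ^ τ / τ)) (𝓝[>] 0) (𝓝 (-ε * c ^ q)) := by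
  refine HasDerivAt.lhopital_zero_nhdsGT (f' := fun r => -ε * r ^ (τ - 1) * w r ^ q)
    (g' := fun r => r ^ (τ - 1)) ?_ ?_ ?_ hF ?_ ?_
  · filter_upwards [Ioo_mem_nhdsGT_zero hρ] with r hr using (h r hr).2.2
  · filter_upwards [Ioo_mem_nhdsGT_zero hρ] with r hr using hasDerivAt_rpow_div hτ.ne' hr.1
  · filter_upwards [Ioo_mem_nhdsGT_zero hρ] with r hr using (Real.rpow_pos_of_pos hr.1 _).ne'
  · simpa using (tendsto_rpow_nhdsGT_zero hτ).div_const τ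
  · refine (tendsto_const_nhds.mul (hw.rpow_const (Or.inr hq.le))).congr' ?_
    filter_upwards [Ioo_mem_nhdsGT_zero hρ] with r hr
    have := (Real.rpow_pos_of_pos hr.1 (τ - 1)).ne'
    field_simp

lemma IsFluxSystem.tendsto_deriv_of_flux_zero (hτ : 0 < τ) (hm : 0 < m) (hq : 0 < q) (hρ : 0 < ρ)
    (h : IsFluxSystem θ τ m q ε (Ioo 0 ρ) w F) (hw : Tendsto w (𝓝[>] 0) (𝓝 c))
    (hF : Tendsto F (𝓝[>] 0) (𝓝 0)) :
    Tendsto (fun r : ℝ => r ^ (-(θ - 1 + τ * m)) * deriv w r) (𝓝[>] 0)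
      (𝓝 (spow m (-ε * c ^ q / τ))) := by
  have h1 := (h.tendsto_flux_div hτ hq hρ hw hF).div_const τ
  refine (((continuous_spow hm).tendsto _).comp h1).congr' ?_
  filter_upwards [Ioo_mem_nhdsGT_zero hρ] with r hr
  have h2 : F r / (r ^ τ / τ) / τ = r ^ (-τ) * F r := by
    rw [Real.rpow_neg hr.1.le]
    field_simp
  rw [(h r hr).2.1.deriv, Function.comp_apply, h2, spow_mul_of_pos (Real.rpow_pos_of_pos hr.1 _),
    ← mul_assoc, ← Real.rpow_add hr.1, ← Real.rpow_mul hr.1.le]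
  ring_nf

lemma IsFluxSystem.tendsto_div_of_zero {F₀ : ℝ} (hθ : 0 < θ) (hm : 0 < m) (hρ : 0 < ρ)
    (h : IsFluxSystem θ τ m q ε (Ioo 0 ρ) w F) (hw : Tendsto w (𝓝[>] 0) (𝓝 0))
    (hF : Tendsto F (𝓝[>] 0) (𝓝 F₀)) :
    Tendsto (fun r : ℝ => r ^ (-θ) * w r) (𝓝[>] 0) (𝓝 (spow m F₀ / θ)) := by
  have h1 : Tendsto (fun r => w r / (r ^ θ / θ)) (𝓝[>] 0) (𝓝 (spow m F₀)) := by
    refine HasDerivAt.lhopital_zero_nhdsGT (f' := fun r => r ^ (θ - 1) * spow m (F r))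
      (g' := fun r => r ^ (θ - 1)) ?_ ?_ ?_ hw ?_ ?_
    · filter_upwards [Ioo_mem_nhdsGT_zero hρ] with r hr using (h r hr).2.1
    · filter_upwards [Ioo_mem_nhdsGT_zero hρ] with r hr using hasDerivAt_rpow_div hθ.ne' hr.1
    · filter_upwards [Ioo_mem_nhdsGT_zero hρ] with r hr using (Real.rpow_pos_of_pos hr.1 _).ne'
    · simpa using (tendsto_rpow_nhdsGT_zero hθ).div_const θ
    · refine (((continuous_spow hm).tendsto _).comp hF).congr' ?_
      filter_upwards [Ioo_mem_nhdsGT_zero hρ] with r hr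
      have := (Real.rpow_pos_of_pos hr.1 (θ - 1)).ne'
      simp only [Function.comp_apply]
      field_simp
  refine (h1.div_const θ).congr' ?_
  filter_upwards [Ioo_mem_nhdsGT_zero hρ] with r hr
  rw [Real.rpow_neg hr.1.le]
  field_simp

/-- A solution which vanishes at the origin has a positive flux there. -/
lemma IsFluxSystem.flux_limit_pos {F₀ : ℝ} (hθ : 0 < θ) (hτ : 0 < τ) (hm : 0 < m) (hq : 0 < q)
    (hmq : 1 < m * q) (hε : ε = 1 ∨ ε = -1) (hρ : 0 < ρ)
    (h : IsFluxSystem θ τ m q ε (Ioo 0 ρ) w F) (hw : Tendsto w (𝓝[>] 0) (𝓝 0))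
    (hF : Tendsto F (𝓝[>] 0) (𝓝 F₀)) : 0 < F₀ := by
  by_contra! hF₀
  -- a nonpositive flux on some `(0, r]` is impossible
  have key : ∀ r, 0 < r → r < ρ → ¬ ∀ s, 0 < s → s ≤ r → F s ≤ 0 := by
    intro r hr hrρ hcon
    have := le_of_tendsto_of_deriv_nonpos hr
      (fun s h1 h2 => (h s ⟨h1, h2.trans_lt hrρ⟩).2.1)
      (fun s h1 h2 => mul_nonpos_of_nonneg_of_nonpos (Real.rpow_nonneg h1.le _)
        (spow_nonpos (hcon s h1 h2))) hw
    exact absurd (h r ⟨hr, hrρ⟩).1 (by linarith)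
  have hpos : ∀ r ∈ Ioo 0 ρ, 0 < r ^ (τ - 1) * w r ^ q := fun r hr =>
    mul_pos (Real.rpow_pos_of_pos hr.1 _) (Real.rpow_pos_of_pos (h r hr).1 _)
  rcases hε with rfl | rfl
  · refine key (ρ / 2) (by linarith) (by linarith) fun s h1 h2 => ?_
    refine le_trans (le_of_tendsto_of_deriv_nonpos h1
      (fun t h3 h4 => (h t ⟨h3, by linarith⟩).2.2) (fun t h3 h4 => ?_) hF) hF₀
    linarith [hpos t ⟨h3, by linarith⟩]
  · rcases hF₀.lt_or_eq with hneg | rfl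
    · obtain ⟨s, hs, hsw⟩ := (mem_nhdsGT_iff_exists_Ioo_subset).1
        (inter_mem (Ioo_mem_nhdsGT_zero hρ) (hF.eventually_lt_const hneg))
      have hs0 : 0 < s := hs
      have h1 : s / 2 ∈ Ioo 0 s := ⟨by linarith, by linarith⟩
      refine key (s / 2) h1.1 (hsw h1).1.2 fun t h2 h3 => ?_
      exact (show F t < 0 from (hsw ⟨h2, by linarith⟩).2).le
    -- The remaining case is `w → 0`, `F → 0` with `ε = -1`. Both functions then increase from `0`;
    -- integrating twice bounds `w r` by a constant times `w(r)^(m q) r^κ`. After division by `w r`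
    -- this is absurd for small `r`, because `m q > 1`.
    · have hFpos : ∀ r ∈ Ioo 0 ρ, 0 ≤ F r := by
        intro r hr
        have := le_of_tendsto_of_deriv_nonpos hr.1
          (fun t h3 h4 => (h t ⟨h3, h4.trans_lt hr.2⟩).2.2.neg)
          (fun t h3 h4 => by linarith [hpos t ⟨h3, h4.trans_lt hr.2⟩]) hF.neg
        simp only [Pi.neg_apply] at this
        linarith
      have hspow : ∀ r ∈ Ioo 0 ρ, spow m (F r) = F r ^ m := by
        intro r hr
        rcases (hFpos r hr).eq_or_lt with h0 | h0
        · rw [← h0, spow_zero, Real.zero_rpow hm.ne']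
        · exact spow_of_pos h0
      have hwmono : ∀ r ∈ Ioo 0 ρ, ∀ s, 0 < s → s ≤ r → w s ≤ w r := by
        intro r hr s h1 h2
        have := antitoneOn_Ioc_of_hasDerivAt (g := fun x => -w x) (r := r)
          (fun t h3 h4 => (h t ⟨h3, h4.trans_lt hr.2⟩).2.1.neg)
          (fun t h3 h4 => by
            have h5 : t ∈ Ioo 0 ρ := ⟨h3, h4.trans_lt hr.2⟩
            rw [hspow t h5]
            have := mul_nonneg (Real.rpow_nonneg h3.le (θ - 1))
              (Real.rpow_nonneg (hFpos t h5) m)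
            linarith) ⟨h1, h2⟩ ⟨hr.1, le_rfl⟩ h2
        simpa using this
      have hFle : ∀ r ∈ Ioo 0 ρ, ∀ s, 0 < s → s ≤ r → F s ≤ w r ^ q * (s ^ τ / τ) := by
        intro r hr s h1 h2
        have hlim : Tendsto (fun x => F x - w r ^ q * (x ^ τ / τ)) (𝓝[>] 0) (𝓝 0) := by
          simpa using hF.sub (((tendsto_rpow_nhdsGT_zero hτ).div_const τ).const_mul (w r ^ q))
        have := le_of_tendsto_of_deriv_nonpos (L := 0) h1
          (fun t h3 h4 => (h t ⟨h3, by linarith [hr.2]⟩).2.2.sub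
            ((hasDerivAt_rpow_div hτ.ne' h3).const_mul (w r ^ q)))
          (fun t h3 h4 => by
            have h5 : w t ^ q ≤ w r ^ q := Real.rpow_le_rpow (h t ⟨h3, by linarith [hr.2]⟩).1.le
              (hwmono r hr t h3 (h4.trans h2)) hq.le
            have h6 := Real.rpow_pos_of_pos h3 (τ - 1)
            nlinarith) hlim
        simp only [Pi.sub_apply] at this
        linarith
      set κ := θ + τ * m with hκ
      have hκ0 : 0 < κ := by positivity
      have hwle : ∀ r ∈ Ioo 0 ρ, w r ≤ w r ^ (m * q) * (τ ^ m)⁻¹ * (r ^ κ / κ) := by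
        intro r hr
        have hlim : Tendsto (fun x => w x - w r ^ (m * q) * (τ ^ m)⁻¹ * (x ^ κ / κ))
            (𝓝[>] 0) (𝓝 0) := by
          simpa using hw.sub (((tendsto_rpow_nhdsGT_zero hκ0).div_const κ).const_mul _)
        have := le_of_tendsto_of_deriv_nonpos (L := 0) hr.1
          (fun t h3 h4 => (h t ⟨h3, h4.trans_lt hr.2⟩).2.1.sub
            ((hasDerivAt_rpow_div hκ0.ne' h3).const_mul (w r ^ (m * q) * (τ ^ m)⁻¹)))
          (fun t h3 h4 => by
            have h5 : t ∈ Ioo 0 ρ := ⟨h3, h4.trans_lt hr.2⟩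
            have hwr := (h r hr).1
            rw [hspow t h5]
            have h6 : F t ^ m ≤ (w r ^ q * (t ^ τ / τ)) ^ m :=
              Real.rpow_le_rpow (hFpos t h5) (hFle r hr t h3 h4) hm.le
            rw [Real.mul_rpow (by positivity) (by positivity),
              Real.div_rpow (by positivity) hτ.le, ← Real.rpow_mul hwr.le,
              ← Real.rpow_mul h3.le] at h6
            have h7 : t ^ (κ - 1) = t ^ (θ - 1) * t ^ (τ * m) := by
              rw [← Real.rpow_add h3, hκ]; ring_nf
            rw [h7, mul_comm m q]
            have h8 := mul_le_mul_of_nonneg_left h6 (Real.rpow_nonneg h3.le (θ - 1))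
            have h9 : t ^ (θ - 1) * (w r ^ (q * m) * (t ^ (τ * m) / τ ^ m)) =
              w r ^ (q * m) * (τ ^ m)⁻¹ * (t ^ (θ - 1) * t ^ (τ * m)) := by ring
            linarith) hlim
        simp only [Pi.sub_apply] at this
        linarith
      have hlim : Tendsto (fun r => w r ^ (m * q - 1) * (τ ^ m)⁻¹ * (r ^ κ / κ)) (𝓝[>] 0) (𝓝 0) := by
        simpa using ((hw.rpow_const (Or.inr (by linarith : 0 ≤ m * q - 1))).mul_const
          ((τ ^ m)⁻¹)).mul ((tendsto_rpow_nhdsGT_zero hκ0).div_const κ)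
      obtain ⟨r, hr1, hr⟩ := ((hlim.eventually_lt_const one_pos).and
        (Ioo_mem_nhdsGT_zero hρ)).exists
      have h2 := hwle r hr
      have hwr := (h r hr).1
      have h3 : w r ^ (m * q) = w r ^ (m * q - 1) * w r := by
        rw [← Real.rpow_add_one hwr.ne']; ring_nf
      rw [h3] at h2
      nlinarith
end

/-- The three possible behaviours at the origin. -/
theorem IsFluxSystem.trichotomy {θ τ m q ε ρ c : ℝ} {w F : ℝ → ℝ} (hθ : 0 < θ) (hτ : 0 < τ)
    (hm : 0 < m) (hq : 0 < q) (hmq : 1 < m * q) (hε : ε = 1 ∨ ε = -1) (hρ : 0 < ρ) (hc : 0 ≤ c)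
    (h : IsFluxSystem θ τ m q ε (Ioo 0 ρ) w F) (hw : Tendsto w (𝓝[>] 0) (𝓝 c)) :
    (0 < c ∧ Tendsto F (𝓝[>] 0) (𝓝 0)) ∨
    (c = 0 ∧ ∃ F₀, 0 < F₀ ∧ Tendsto F (𝓝[>] 0) (𝓝 F₀)) ∨
    (0 < c ∧ ∃ F₀, F₀ ≠ 0 ∧ Tendsto F (𝓝[>] 0) (𝓝 F₀)) := by
  obtain ⟨F₀, hF⟩ := h.exists_flux_limit hτ hq hε hρ hw
  rcases hc.eq_or_lt with rfl | hc
  · exact Or.inr (Or.inl ⟨rfl, F₀, h.flux_limit_pos hθ hτ hm hq hmq hε hρ hw hF, hF⟩)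
  · rcases eq_or_ne F₀ 0 with rfl | h0
    · exact Or.inl ⟨hc, hF⟩
    · exact Or.inr (Or.inr ⟨hc, F₀, h0, hF⟩)

/-! ### Local existence by a contraction on the integral equations. -/

/-- The primitive of `t^(α-1) f(t)` which vanishes at `0`. -/
noncomputable def weightedPrimitive (α : ℝ) (f : ℝ → ℝ) (s : ℝ) : ℝ :=
  ∫ t in (0 : ℝ)..s, t ^ (α - 1) * f t

section
variable {α : ℝ} {f g : ℝ → ℝ}

lemma intervalIntegrable_weighted (hα : 0 < α) (hf : Continuous f) (a b : ℝ) :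
    IntervalIntegrable (fun t : ℝ => t ^ (α - 1) * f t) MeasureTheory.volume a b :=
  (intervalIntegral.intervalIntegrable_rpow' (by linarith)).mul_continuousOn hf.continuousOn

lemma continuous_weightedPrimitive (hα : 0 < α) (hf : Continuous f) :
    Continuous (weightedPrimitive α f) :=
  intervalIntegral.continuous_primitive (intervalIntegrable_weighted hα hf) 0

lemma weightedPrimitive_zero : weightedPrimitive α f 0 = 0 := by simp [weightedPrimitive]

lemma hasDerivAt_weightedPrimitive (hα : 0 < α) (hf : Continuous f) {r : ℝ} (hr : 0 < r) :
    HasDerivAt (weightedPrimitive α f) (r ^ (α - 1) * f r) r := by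
  have hc : ContinuousOn (fun t : ℝ => t ^ (α - 1) * f t) (Ioi 0) :=
    (continuousOn_id.rpow_const fun t ht => Or.inl (ne_of_gt ht)).mul hf.continuousOn
  exact intervalIntegral.integral_hasDerivAt_right (intervalIntegrable_weighted hα hf 0 r)
    (hc.stronglyMeasurableAtFilter isOpen_Ioi r hr) (hc.continuousAt (Ioi_mem_nhds hr))

lemma weightedPrimitive_const (hα : 0 < α) (C s : ℝ) :
    weightedPrimitive α (fun _ => C) s = C * (s ^ α / α) := by
  rw [weightedPrimitive, intervalIntegral.integral_mul_const, integral_rpow (Or.inl (by linarith)),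
    sub_add_cancel, Real.zero_rpow hα.ne', sub_zero, mul_comm]

lemma weightedPrimitive_mono (hα : 0 < α) (hf : Continuous f) (hg : Continuous g) {s : ℝ}
    (hs : 0 ≤ s) (h : ∀ t ∈ Icc 0 s, f t ≤ g t) :
    weightedPrimitive α f s ≤ weightedPrimitive α g s :=
  intervalIntegral.integral_mono_on hs (intervalIntegrable_weighted hα hf 0 s)
    (intervalIntegrable_weighted hα hg 0 s)
    fun t ht => mul_le_mul_of_nonneg_left (h t ht) (Real.rpow_nonneg ht.1 _)

lemma weightedPrimitive_sub (hα : 0 < α) (hf : Continuous f) (hg : Continuous g) (s : ℝ) :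
    weightedPrimitive α f s - weightedPrimitive α g s
      = weightedPrimitive α (fun t => f t - g t) s := by
  rw [weightedPrimitive, weightedPrimitive, ← intervalIntegral.integral_sub
    (intervalIntegrable_weighted hα hf 0 s) (intervalIntegrable_weighted hα hg 0 s)]
  simp only [weightedPrimitive, mul_sub]

lemma abs_weightedPrimitive_le (hα : 0 < α) (hf : Continuous f) {s C : ℝ}
    (hs : 0 ≤ s) (h : ∀ t ∈ Icc 0 s, |f t| ≤ C) :
    |weightedPrimitive α f s| ≤ C * (s ^ α / α) := by
  rw [abs_le, ← neg_mul, ← weightedPrimitive_const hα, ← weightedPrimitive_const hα]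
  exact ⟨weightedPrimitive_mono hα continuous_const hf hs fun t ht => (abs_le.1 (h t ht)).1,
    weightedPrimitive_mono hα hf continuous_const hs fun t ht => (abs_le.1 (h t ht)).2⟩
end

/-- Powers are Lipschitz on compact subintervals of `(0, ∞)`. -/
lemma exists_lipschitz_rpow (q : ℝ) {l h : ℝ} (hl : 0 < l) :
    ∃ K, 0 ≤ K ∧ ∀ x ∈ Icc l h, ∀ y ∈ Icc l h, |x ^ q - y ^ q| ≤ K * |x - y| := by
  have hc : ContinuousOn (fun x : ℝ => q * x ^ (q - 1)) (Icc l h) :=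
    continuousOn_const.mul (continuousOn_id.rpow_const fun x hx => Or.inl (hl.trans_le hx.1).ne')
  obtain ⟨K, hK⟩ := isCompact_Icc.exists_bound_of_continuousOn hc
  refine ⟨max K 0, le_max_right _ _, fun x hx y hy => ?_⟩
  have := (convex_Icc l h).norm_image_sub_le_of_norm_hasDerivWithin_le
    (f := fun x : ℝ => x ^ q) (f' := fun x => q * x ^ (q - 1)) (C := max K 0)
    (fun z hz => (Real.hasDerivAt_rpow_const (Or.inl (hl.trans_le hz.1).ne')).hasDerivWithinAt)
    (fun z hz => (hK z hz).trans (le_max_left _ _)) hy hx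
  simpa [Real.norm_eq_abs] using this

section
variable {θ τ m q a₀ b₀ e₁ e₂ : ℝ}

/-- The second component `b₀ + e₂ ∫ t^(τ-1) z^q` attached to a first component `z`. -/
noncomputable def secondComponent (τ q b₀ e₂ : ℝ) (z : ℝ → ℝ) (s : ℝ) : ℝ :=
  b₀ + e₂ * weightedPrimitive τ (fun t => z t ^ q) s

lemma continuous_secondComponent (hτ : 0 < τ) (hq : 0 < q) {z : ℝ → ℝ} (hz : Continuous z) :
    Continuous (secondComponent τ q b₀ e₂ z) :=
  continuous_const.add (continuous_const.mul (continuous_weightedPrimitive hτ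
    (hz.rpow_const fun _ => Or.inr hq.le)))

/-- Uniform bounds on the `m`-th power of the second component. -/
lemma exists_secondComponent_bounds (hτ : 0 < τ) (hm : 0 < m) (hq : 0 < q) (ha₀ : 0 < a₀)
    (hb₀ : 0 ≤ b₀) (he₂ : e₂ = 1 ∨ e₂ = -1) (hbe : b₀ = 0 → e₂ = 1) :
    ∃ ρ K M : ℝ, 0 < ρ ∧ 0 ≤ K ∧ 0 ≤ M ∧
      (∀ z : ℝ → ℝ, Continuous z → (∀ t, z t ∈ Icc (a₀ / 2) (2 * a₀)) → ∀ s, 0 ≤ s → s ≤ ρ →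
        0 ≤ secondComponent τ q b₀ e₂ z s ∧ (0 < s → 0 < secondComponent τ q b₀ e₂ z s) ∧
        secondComponent τ q b₀ e₂ z s ^ m ≤ M) ∧
      ∀ z₁ z₂ : ℝ → ℝ, Continuous z₁ → Continuous z₂ →
        (∀ t, z₁ t ∈ Icc (a₀ / 2) (2 * a₀)) → (∀ t, z₂ t ∈ Icc (a₀ / 2) (2 * a₀)) →
        ∀ ζ, 0 ≤ ζ → (∀ t, |z₁ t - z₂ t| ≤ ζ) → ∀ s, 0 ≤ s → s ≤ ρ →
        |secondComponent τ q b₀ e₂ z₁ s ^ m - secondComponent τ q b₀ e₂ z₂ s ^ m| ≤ K * ζ := by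
  obtain ⟨Kq, hKq0, hKq⟩ := exists_lipschitz_rpow q (l := a₀ / 2) (h := 2 * a₀) (by positivity)
  set lo := (a₀ / 2) ^ q with hlo
  set hi := (2 * a₀) ^ q with hhi
  have hlo0 : 0 < lo := by positivity
  have hhi0 : 0 < hi := by positivity
  have hzc : ∀ z : ℝ → ℝ, Continuous z → Continuous fun t => z t ^ q := fun z hz =>
    hz.rpow_const fun _ => Or.inr hq.le
  have hG : ∀ z : ℝ → ℝ, Continuous z → (∀ t, z t ∈ Icc (a₀ / 2) (2 * a₀)) → ∀ s, 0 ≤ s →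
      lo * (s ^ τ / τ) ≤ weightedPrimitive τ (fun t => z t ^ q) s ∧
      weightedPrimitive τ (fun t => z t ^ q) s ≤ hi * (s ^ τ / τ) := by
    intro z hz hzI s hs
    rw [← weightedPrimitive_const hτ, ← weightedPrimitive_const hτ]
    exact ⟨weightedPrimitive_mono hτ continuous_const (hzc z hz) hs fun t _ =>
        Real.rpow_le_rpow (by positivity) (hzI t).1 hq.le,
      weightedPrimitive_mono hτ (hzc z hz) continuous_const hs fun t _ =>
        Real.rpow_le_rpow (by have := (hzI t).1; linarith) (hzI t).2 hq.le⟩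
  have hGd : ∀ z₁ z₂ : ℝ → ℝ, Continuous z₁ → Continuous z₂ →
        (∀ t, z₁ t ∈ Icc (a₀ / 2) (2 * a₀)) → (∀ t, z₂ t ∈ Icc (a₀ / 2) (2 * a₀)) →
        ∀ ζ, 0 ≤ ζ → (∀ t, |z₁ t - z₂ t| ≤ ζ) → ∀ s, 0 ≤ s →
        |weightedPrimitive τ (fun t => z₁ t ^ q) s - weightedPrimitive τ (fun t => z₂ t ^ q) s|
          ≤ Kq * ζ * (s ^ τ / τ) := by
    intro z₁ z₂ h1 h2 hI1 hI2 ζ _ hd s hs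
    rw [weightedPrimitive_sub hτ (hzc z₁ h1) (hzc z₂ h2)]
    exact abs_weightedPrimitive_le hτ ((hzc z₁ h1).sub (hzc z₂ h2)) hs fun t _ =>
      (hKq _ (hI1 t) _ (hI2 t)).trans (mul_le_mul_of_nonneg_left (hd t) hKq0)
  rcases hb₀.eq_or_lt with rfl | hb₀
  · obtain rfl := hbe rfl
    -- For `m < 1` the power `b^m` is not Lipschitz at `b = 0`. But `b` is comparable to `s^τ`, so
    -- `b / s^τ` stays in a compact subinterval of `(0, ∞)`, where the power is Lipschitz; the
    -- factor `(s^τ)^m` is at most `1` on `[0, 1]`.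
    obtain ⟨Km, hKm0, hKm⟩ := exists_lipschitz_rpow m (l := lo / τ) (h := hi / τ) (by positivity)
    refine ⟨1, Km * (Kq / τ), (hi / τ) ^ m, one_pos, by positivity, by positivity, ?_, ?_⟩
    · intro z hz hzI s hs hs1
      have h1 := hG z hz hzI s hs
      simp only [secondComponent, zero_add, one_mul]
      have h2 : s ^ τ ≤ 1 := Real.rpow_le_one hs hs1 hτ.le
      have h3 : 0 ≤ weightedPrimitive τ (fun t => z t ^ q) s := le_trans (by positivity) h1.1
      refine ⟨h3, fun hs0 => lt_of_lt_of_le (by positivity) h1.1, ?_⟩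
      refine Real.rpow_le_rpow h3 (h1.2.trans ?_) hm.le
      rw [← mul_div_assoc]
      gcongr
      nlinarith
    · intro z₁ z₂ h1 h2 hI1 hI2 ζ hζ hd s hs hs1
      simp only [secondComponent, zero_add, one_mul]
      rcases hs.eq_or_lt with rfl | hs0
      · rw [weightedPrimitive_zero, weightedPrimitive_zero, sub_self, abs_zero]
        positivity
      have hsτ : 0 < s ^ τ := Real.rpow_pos_of_pos hs0 τ
      have hsτ1 : s ^ τ ≤ 1 := Real.rpow_le_one hs hs1 hτ.le
      have g1 := hG z₁ h1 hI1 s hs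
      have g2 := hG z₂ h2 hI2 s hs
      have gd := hGd z₁ z₂ h1 h2 hI1 hI2 ζ hζ hd s hs
      set G₁ := weightedPrimitive τ (fun t => z₁ t ^ q) s
      set G₂ := weightedPrimitive τ (fun t => z₂ t ^ q) s
      have m1 : ∀ G, lo * (s ^ τ / τ) ≤ G ∧ G ≤ hi * (s ^ τ / τ) →
          G / s ^ τ ∈ Icc (lo / τ) (hi / τ) := by
        rintro G ⟨ha, hb⟩
        constructor
        · rw [le_div_iff₀ hsτ]; exact le_of_eq_of_le (by ring) ha
        · rw [div_le_iff₀ hsτ]; exact hb.trans_eq (by ring)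
      have h3 := hKm _ (m1 G₁ g1) _ (m1 G₂ g2)
      have h4 : ∀ G, lo * (s ^ τ / τ) ≤ G → G ^ m = (s ^ τ) ^ m * (G / s ^ τ) ^ m := by
        intro G hG
        have hG0 : 0 ≤ G := le_trans (by positivity) hG
        rw [← Real.mul_rpow hsτ.le (by positivity), mul_div_cancel₀ _ hsτ.ne']
      rw [h4 G₁ g1.1, h4 G₂ g2.1, ← mul_sub, abs_mul, abs_of_pos (Real.rpow_pos_of_pos hsτ m)]
      have h5 : (s ^ τ) ^ m ≤ 1 := Real.rpow_le_one hsτ.le hsτ1 hm.le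
      have h6 : |G₁ / s ^ τ - G₂ / s ^ τ| ≤ Kq / τ * ζ := by
        rw [← sub_div, abs_div, abs_of_pos hsτ, div_le_iff₀ hsτ]
        exact gd.trans_eq (by ring)
      calc _ ≤ 1 * (Km * (Kq / τ * ζ)) :=
            mul_le_mul h5 (h3.trans (mul_le_mul_of_nonneg_left h6 hKm0)) (abs_nonneg _) zero_le_one
        _ = _ := by ring
  -- For `b₀ > 0` a small radius keeps `b` in `[b₀/2, 2 b₀]` whatever the sign of `e₂`.
  · obtain ⟨Km, hKm0, hKm⟩ := exists_lipschitz_rpow m (l := b₀ / 2) (h := 2 * b₀) (by positivity)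
    have hlim : ∀ᶠ s : ℝ in 𝓝[>] 0, hi * (s ^ τ / τ) < b₀ / 2 := by
      have : Tendsto (fun s : ℝ => hi * (s ^ τ / τ)) (𝓝[>] 0) (𝓝 0) := by
        simpa using ((tendsto_rpow_nhdsGT_zero hτ).div_const τ).const_mul hi
      exact this.eventually_lt_const (by positivity)
    obtain ⟨ρ, hρsmall, hρ, hρ1⟩ := (hlim.and (Ioo_mem_nhdsGT_zero one_pos)).exists
    have hsmall : ∀ s, 0 ≤ s → s ≤ ρ → hi * (s ^ τ / τ) < b₀ / 2 := fun s hs hsρ =>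
      lt_of_le_of_lt (by gcongr) hρsmall
    have hB : ∀ z : ℝ → ℝ, Continuous z → (∀ t, z t ∈ Icc (a₀ / 2) (2 * a₀)) → ∀ s, 0 ≤ s →
        s ≤ ρ → secondComponent τ q b₀ e₂ z s ∈ Icc (b₀ / 2) (2 * b₀) := by
      intro z hz hzI s hs hsρ
      have h1 := hG z hz hzI s hs
      have h2 := hsmall s hs hsρ
      have h3 : 0 ≤ weightedPrimitive τ (fun t => z t ^ q) s := le_trans (by positivity) h1.1
      rcases he₂ with rfl | rfl <;> simp only [secondComponent] <;> constructor <;> linarith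
    refine ⟨ρ, Km * (Kq * (ρ ^ τ / τ)), (2 * b₀) ^ m, hρ, by positivity, by positivity, ?_, ?_⟩
    · intro z hz hzI s hs hsρ
      have h1 := hB z hz hzI s hs hsρ
      have h2 : 0 < secondComponent τ q b₀ e₂ z s := lt_of_lt_of_le (by positivity) h1.1
      exact ⟨h2.le, fun _ => h2, Real.rpow_le_rpow h2.le h1.2 hm.le⟩
    · intro z₁ z₂ h1 h2 hI1 hI2 ζ hζ hd s hs hsρ
      have gd := hGd z₁ z₂ h1 h2 hI1 hI2 ζ hζ hd s hs
      refine (hKm _ (hB z₁ h1 hI1 s hs hsρ) _ (hB z₂ h2 hI2 s hs hsρ)).trans ?_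
      have he : |e₂| = 1 := by rcases he₂ with rfl | rfl <;> simp
      have h3 : secondComponent τ q b₀ e₂ z₁ s - secondComponent τ q b₀ e₂ z₂ s
          = e₂ * (weightedPrimitive τ (fun t => z₁ t ^ q) s
            - weightedPrimitive τ (fun t => z₂ t ^ q) s) := by
        simp only [secondComponent]; ring
      rw [h3, abs_mul, he, one_mul, mul_assoc Km]
      refine mul_le_mul_of_nonneg_left (gd.trans ?_) hKm0
      have : s ^ τ / τ ≤ ρ ^ τ / τ := by gcongr
      calc Kq * ζ * (s ^ τ / τ) ≤ Kq * ζ * (ρ ^ τ / τ) := by gcongr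
        _ = _ := by ring

/-- Local solvability at the origin of `a' = e₁ r^(θ-1) b^m`, `b' = e₂ r^(τ-1) a^q`. -/
theorem exists_local_solution (hθ : 0 < θ) (hτ : 0 < τ) (hm : 0 < m) (hq : 0 < q) (ha₀ : 0 < a₀)
    (hb₀ : 0 ≤ b₀) (he₁ : e₁ = 1 ∨ e₁ = -1) (he₂ : e₂ = 1 ∨ e₂ = -1) (hbe : b₀ = 0 → e₂ = 1) :
    ∃ ρ : ℝ, 0 < ρ ∧ ∃ a b : ℝ → ℝ,
      (∀ r ∈ Ioo 0 ρ, 0 < a r ∧ 0 < b r ∧ HasDerivAt a (e₁ * (r ^ (θ - 1) * b r ^ m)) r ∧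
        HasDerivAt b (e₂ * (r ^ (τ - 1) * a r ^ q)) r) ∧
      Tendsto a (𝓝[>] 0) (𝓝 a₀) ∧ Tendsto b (𝓝[>] 0) (𝓝 b₀) := by
  obtain ⟨ρ₁, K, M, hρ₁, hK, hM, hbd, hlip⟩ :=
    exists_secondComponent_bounds hτ hm hq ha₀ hb₀ he₂ hbe
  -- The bound with `M` keeps the iterates in `[a₀/2, 2 a₀]`; the bound with `K` gives the
  -- contraction factor `1/2`.
  obtain ⟨ρ, ⟨hsK, hsM⟩, hρ, hρρ₁⟩ : ∃ ρ : ℝ, (K * (ρ ^ θ / θ) < 1 / 2 ∧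
      M * (ρ ^ θ / θ) < a₀ / 2) ∧ ρ ∈ Ioo 0 ρ₁ := by
    have h1 : ∀ C : ℝ, Tendsto (fun s : ℝ => C * (s ^ θ / θ)) (𝓝[>] 0) (𝓝 0) := fun C => by
      simpa using ((tendsto_rpow_nhdsGT_zero hθ).div_const θ).const_mul C
    exact ((((h1 K).eventually_lt_const (by norm_num)).and
      ((h1 M).eventually_lt_const (by positivity))).and (Ioo_mem_nhdsGT_zero hρ₁)).exists
  set B : (ℝ → ℝ) → ℝ → ℝ := secondComponent τ q b₀ e₂ with hBdef
  have hBc : ∀ z, Continuous z → Continuous fun s => B z s ^ m := fun z hz =>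
    (continuous_secondComponent hτ hq hz).rpow_const fun _ => Or.inr hm.le
  set A : (ℝ → ℝ) → ℝ → ℝ := fun z r => a₀ + e₁ * weightedPrimitive θ (fun s => B z s ^ m) r
    with hAdef
  have hAc : ∀ z, Continuous z → Continuous (A z) := fun z hz =>
    continuous_const.add (continuous_const.mul (continuous_weightedPrimitive hθ (hBc z hz)))
  have he : |e₁| = 1 := by rcases he₁ with rfl | rfl <;> simp
  have hrθ : ∀ r : ℝ, 0 ≤ r → r ≤ ρ → r ^ θ / θ ≤ ρ ^ θ / θ := fun r h1 h2 => by gcongr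
  have hAI : ∀ z, Continuous z → (∀ t, z t ∈ Icc (a₀ / 2) (2 * a₀)) → ∀ r, 0 ≤ r → r ≤ ρ →
      A z r ∈ Icc (a₀ / 2) (2 * a₀) := by
    intro z hz hzI r h1 h2
    have h3 : |A z r - a₀| ≤ M * (r ^ θ / θ) := by
      simp only [hAdef, add_sub_cancel_left, abs_mul, he, one_mul]
      refine abs_weightedPrimitive_le hθ (hBc z hz) h1 fun t ht => ?_
      obtain ⟨h4, _, h5⟩ := hbd z hz hzI t ht.1 (by linarith [ht.2])
      rwa [abs_of_nonneg (Real.rpow_nonneg h4 m)]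
    have h4 : M * (r ^ θ / θ) ≤ M * (ρ ^ θ / θ) := mul_le_mul_of_nonneg_left (hrθ r h1 h2) hM
    have := abs_le.1 (h3.trans h4)
    constructor <;> linarith
  have hAd : ∀ z₁ z₂ : ℝ → ℝ, Continuous z₁ → Continuous z₂ →
      (∀ t, z₁ t ∈ Icc (a₀ / 2) (2 * a₀)) → (∀ t, z₂ t ∈ Icc (a₀ / 2) (2 * a₀)) →
      ∀ ζ, 0 ≤ ζ → (∀ t, |z₁ t - z₂ t| ≤ ζ) → ∀ r, 0 ≤ r → r ≤ ρ →
      |A z₁ r - A z₂ r| ≤ 1 / 2 * ζ := by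
    intro z₁ z₂ h1 h2 hI1 hI2 ζ hζ hd r hr0 hr
    have h3 : |A z₁ r - A z₂ r| ≤ K * ζ * (r ^ θ / θ) := by
      have : A z₁ r - A z₂ r = e₁ * (weightedPrimitive θ (fun s => B z₁ s ^ m) r
          - weightedPrimitive θ (fun s => B z₂ s ^ m) r) := by simp only [hAdef]; ring
      rw [this, abs_mul, he, one_mul, weightedPrimitive_sub hθ (hBc _ h1) (hBc _ h2)]
      exact abs_weightedPrimitive_le hθ ((hBc _ h1).sub (hBc _ h2)) hr0 fun t ht =>
        hlip z₁ z₂ h1 h2 hI1 hI2 ζ hζ hd t ht.1 (by linarith [ht.2])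
    have h4 : K * ζ * (r ^ θ / θ) ≤ K * ζ * (ρ ^ θ / θ) :=
      mul_le_mul_of_nonneg_left (hrθ r hr0 hr) (by positivity)
    nlinarith
  have hext : ∀ z : C(Icc (0 : ℝ) ρ, ℝ), Continuous (IccExtend hρ.le z) := fun z =>
    z.continuous.Icc_extend'
  set S : Set C(Icc (0 : ℝ) ρ, ℝ) := {z | ∀ r, z r ∈ Icc (a₀ / 2) (2 * a₀)} with hS
  have hSc : IsClosed S := by
    rw [hS, ofPred_forall]
    exact isClosed_iInter fun r => isClosed_Icc.preimage (continuous_eval_const r)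
  have hSI : ∀ z ∈ S, ∀ t, IccExtend hρ.le z t ∈ Icc (a₀ / 2) (2 * a₀) := fun z hz t => hz _
  let T : C(Icc (0 : ℝ) ρ, ℝ) → C(Icc (0 : ℝ) ρ, ℝ) := fun z =>
    ⟨fun r => A (IccExtend hρ.le z) r, (hAc _ (hext z)).comp continuous_subtype_val⟩
  have hTS : MapsTo T S S := fun z hz r => hAI _ (hext z) (hSI z hz) r r.2.1 r.2.2
  have hcontr : ContractingWith (1 / 2) (hTS.restrict T S S) := by
    refine ⟨by norm_num, LipschitzWith.of_dist_le_mul fun z₁ z₂ => ?_⟩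
    rw [Subtype.dist_eq, Subtype.dist_eq]
    refine (ContinuousMap.dist_le (by positivity)).2 fun r => ?_
    rw [Real.dist_eq]
    exact hAd _ _ (hext z₁.1) (hext z₂.1) (hSI _ z₁.2) (hSI _ z₂.2) _ dist_nonneg
      (fun t => by
        rw [← Real.dist_eq]
        exact ContinuousMap.dist_apply_le_dist (f := z₁.1) (g := z₂.1) (projIcc 0 ρ hρ.le t))
      r r.2.1 r.2.2
  obtain ⟨z, hzS, hz, -⟩ := hcontr.exists_fixedPoint' hSc.isComplete
    hTS (x := ContinuousMap.const _ a₀) (fun r => ⟨by simp; linarith, by simp; linarith⟩)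
    (edist_ne_top _ _)
  set Z := IccExtend hρ.le z with hZ
  have hZA : ∀ r ∈ Ioo 0 ρ, Z r = A Z r := by
    intro r hr
    rw [hZ, IccExtend_of_mem _ _ ⟨hr.1.le, hr.2.le⟩]
    exact (DFunLike.congr_fun hz ⟨r, hr.1.le, hr.2.le⟩).symm
  have hZc : Continuous Z := hext z
  have hZq : Continuous fun t => Z t ^ q := hZc.rpow_const fun _ => Or.inr hq.le
  -- The fixed point `Z` equals `A Z` only on the interval. The solution is taken to be `A Z`, which
  -- is differentiable at every `r > 0` as a primitive.
  refine ⟨ρ, hρ, A Z, B Z, fun r hr => ⟨?_, ?_, ?_, ?_⟩, ?_, ?_⟩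
  · exact lt_of_lt_of_le (by positivity) (hAI Z hZc (hSI z hzS) r hr.1.le hr.2.le).1
  · exact (hbd Z hZc (hSI z hzS) r hr.1.le (by linarith [hr.2])).2.1 hr.1
  · exact ((hasDerivAt_weightedPrimitive hθ (hBc Z hZc) hr.1).const_mul e₁).const_add a₀
  · rw [← hZA r hr]
    exact ((hasDerivAt_weightedPrimitive hτ hZq hr.1).const_mul e₂).const_add b₀
  · have := (hAc Z hZc).tendsto 0
    simp only [hAdef, weightedPrimitive_zero, mul_zero, add_zero] at this
    exact this.mono_left nhdsWithin_le_nhds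
  · have := (continuous_secondComponent (b₀ := b₀) (e₂ := e₂) hτ hq hZc).tendsto 0
    simp only [secondComponent, weightedPrimitive_zero, mul_zero, add_zero] at this
    exact this.mono_left nhdsWithin_le_nhds
end

/-! ### Classification of the local regular solutions. -/

section
variable {N p q σ ε : ℝ} {I : Set ℝ} {w F : ℝ → ℝ}

lemma IsFluxSystem.isC0Regular (hp : 1 < p) (hI : I ⊆ Ioi 0) (hIo : IsOpen I)
    (h : IsFluxSystem ((p - N) / (p - 1)) (N + σ) (1 / (p - 1)) q ε I w F)
    (hF : ∀ r ∈ I, F r ≠ 0) {c : ℝ} (hc : 0 ≤ c) (hw : Tendsto w (𝓝[>] 0) (𝓝 c)) :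
    IsC0Regular N p q σ ε I w :=
  ⟨h.isPositiveSolution hp hI hIo, h.contDiffOn hI hIo hF, c, hc, hw⟩

lemma IsFluxSystem.regularAtZero {ρ c : ℝ} (hp : 1 < p) (hq : 0 < q)
    (hτ : 0 < N + σ) (hρ : 0 < ρ) (hε : ε = 1 ∨ ε = -1) (hc : 0 < c)
    (h : IsFluxSystem ((p - N) / (p - 1)) (N + σ) (1 / (p - 1)) q ε (Ioo 0 ρ) w F)
    (hw : Tendsto w (𝓝[>] 0) (𝓝 c)) (hF : Tendsto F (𝓝[>] 0) (𝓝 0)) :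
    RegularAtZero p σ c (-ε * (c ^ q / (N + σ)) ^ (1 / (p - 1))) w := by
  have hp1 : 0 < p - 1 := by linarith
  refine ⟨hw, ?_⟩
  have h1 := h.tendsto_deriv_of_flux_zero hτ (by positivity) hq hρ hw hF
  have h2 : (p - N) / (p - 1) - 1 + (N + σ) * (1 / (p - 1)) = (σ + 1) / (p - 1) := by
    field_simp; ring
  rw [h2] at h1
  have h3 : 0 < c ^ q / (N + σ) := by positivity
  convert h1 using 2
  rcases hε with rfl | rfl
  · rw [show -1 * c ^ q / (N + σ) = -(c ^ q / (N + σ)) by ring, spow_neg, spow_of_pos h3]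
    ring
  · rw [show - -1 * c ^ q / (N + σ) = c ^ q / (N + σ) by ring, spow_of_pos h3]
    ring

lemma IsFluxSystem.fluxAtZero {τ ρ c F₀ : ℝ} (hp : 1 < p) (hρ : 0 < ρ)
    (h : IsFluxSystem ((p - N) / (p - 1)) τ (1 / (p - 1)) q ε (Ioo 0 ρ) w F)
    (hw : Tendsto w (𝓝[>] 0) (𝓝 c)) (hF : Tendsto F (𝓝[>] 0) (𝓝 F₀)) :
    FluxAtZero N p c (spow (1 / (p - 1)) F₀) w := by
  have hp1 : 0 < p - 1 := by linarith
  refine ⟨hw, ?_⟩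
  have h1 := h.tendsto_deriv (by positivity) hρ hF
  rwa [show 1 - (p - N) / (p - 1) = (N - 1) / (p - 1) by field_simp; ring] at h1

lemma IsFluxSystem.vanishingAtZero {τ ρ F₀ : ℝ} (hp : 1 < p) (hNp : N < p) (hρ : 0 < ρ)
    (hF₀ : 0 < F₀)
    (h : IsFluxSystem ((p - N) / (p - 1)) τ (1 / (p - 1)) q ε (Ioo 0 ρ) w F)
    (hw : Tendsto w (𝓝[>] 0) (𝓝 0)) (hF : Tendsto F (𝓝[>] 0) (𝓝 F₀)) :
    VanishingAtZero N p (F₀ ^ (1 / (p - 1)) / ((p - N) / (p - 1))) (F₀ ^ (1 / (p - 1))) w := by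
  have hp1 : 0 < p - 1 := by linarith
  have hNp' : 0 < p - N := by linarith
  have h1 := (h.fluxAtZero hp hρ hw hF).2
  have h2 := h.tendsto_div_of_zero (by positivity) (by positivity) hρ hw hF
  rw [spow_of_pos hF₀] at h1 h2
  rw [show -((p - N) / (p - 1)) = (N - p) / (p - 1) by ring] at h2
  exact ⟨hw, h2, h1⟩

end

/-- Existence and classification of the local `C^0`-regular solutions. -/
theorem local_classification {N p q σ : ℝ} (hp : 1 < p) (hq : p - 1 < q) (hNp : N < p)
    (hσN : -σ < N) :
    ∃ c₁ c₂ : ℝ → ℝ, (∀ x : ℝ, 0 < x → 0 < c₁ x ∧ 0 < c₂ x) ∧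
      ∀ ε : ℝ, (ε = 1 ∨ ε = -1) →
        (∀ w₀ : ℝ, 0 < w₀ → ∃ ρ : ℝ, 0 < ρ ∧ ∃ w : ℝ → ℝ,
          IsC0Regular N p q σ ε (Ioo 0 ρ) w ∧ RegularAtZero p σ w₀ (-ε * c₁ w₀) w) ∧
        (∀ k : ℝ, 0 < k → ∃ ρ : ℝ, 0 < ρ ∧ ∃ w : ℝ → ℝ,
          IsC0Regular N p q σ ε (Ioo 0 ρ) w ∧ VanishingAtZero N p k (c₂ k) w) ∧
        (∀ w₀ d : ℝ, 0 < w₀ → d ≠ 0 → ∃ ρ : ℝ, 0 < ρ ∧ ∃ w : ℝ → ℝ,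
          IsC0Regular N p q σ ε (Ioo 0 ρ) w ∧ FluxAtZero N p w₀ d w) ∧
        (∀ (ρ : ℝ) (w : ℝ → ℝ), 0 < ρ → IsC0Regular N p q σ ε (Ioo 0 ρ) w →
          (∃ w₀ : ℝ, 0 < w₀ ∧ RegularAtZero p σ w₀ (-ε * c₁ w₀) w) ∨
          (∃ k : ℝ, 0 < k ∧ VanishingAtZero N p k (c₂ k) w) ∨
          (∃ w₀ d : ℝ, 0 < w₀ ∧ d ≠ 0 ∧ FluxAtZero N p w₀ d w)) := by
  have hp1 : 0 < p - 1 := by linarith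
  have hq0 : 0 < q := by linarith
  have hτ : 0 < N + σ := by linarith
  have hθ : 0 < (p - N) / (p - 1) := div_pos (by linarith) hp1
  have hm : 0 < 1 / (p - 1) := by positivity
  have hmq : 1 < 1 / (p - 1) * q := by rw [one_div_mul_eq_div, one_lt_div hp1]; exact hq
  set θ := (p - N) / (p - 1) with hθdef
  set τ := N + σ with hτdef
  set m := 1 / (p - 1) with hmdef
  refine ⟨fun x => (x ^ q / τ) ^ m, fun x => θ * x, fun x hx => ⟨by positivity, by positivity⟩,
    fun ε hε => ⟨?_, ?_, ?_, ?_⟩⟩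
  · intro w₀ hw₀
    -- With zero initial flux the unknown `b` must grow from `0`, so the sign is carried by `F = -ε
    -- b`. Then `F` has no zero, which is what yields class `C^2`.
    obtain ⟨ρ, hρ, a, b, hab, ha, hb⟩ := exists_local_solution (e₁ := -ε) (e₂ := 1) hθ hτ hm hq0
      hw₀ le_rfl (by rcases hε with rfl | rfl <;> simp) (Or.inl rfl) fun _ => rfl
    have hsys : IsFluxSystem θ τ m q ε (Ioo 0 ρ) a (fun r => -ε * b r) := by
      intro r hr
      obtain ⟨h1, h2, h3, h4⟩ := hab r hr
      refine ⟨h1, h3.congr_deriv ?_, (h4.const_mul (-ε)).congr_deriv (by ring)⟩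
      beta_reduce
      rcases hε with rfl | rfl
      · rw [neg_one_mul (b r), spow_neg, spow_of_pos h2]; ring
      · rw [neg_neg, one_mul, one_mul, spow_of_pos h2]
    refine ⟨ρ, hρ, a, hsys.isC0Regular hp Ioo_subset_Ioi_self isOpen_Ioo (fun r hr => ?_) hw₀.le ha,
      hsys.regularAtZero hp hq0 hτ hρ hε hw₀ ha (by simpa using hb.const_mul (-ε))⟩
    exact mul_ne_zero (by rcases hε with rfl | rfl <;> norm_num) (hab r hr).2.1.ne'
  · intro k hk
    -- Here the roles are exchanged: `a` is the flux and `b` is `w`. Since `w ~ F₀^m r^θ/θ`, the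
    -- value `k` requires `F₀ = (θ k)^(p-1)`.
    obtain ⟨ρ, hρ, a, b, hab, ha, hb⟩ := exists_local_solution (e₁ := -ε) (e₂ := 1)
      (a₀ := (θ * k) ^ (p - 1)) hτ hθ hq0 hm
      (by positivity) le_rfl (by rcases hε with rfl | rfl <;> simp) (Or.inl rfl) fun _ => rfl
    have hsys : IsFluxSystem θ τ m q ε (Ioo 0 ρ) b a := by
      intro r hr
      obtain ⟨h1, h2, h3, h4⟩ := hab r hr
      refine ⟨h2, h4.congr_deriv ?_, h3.congr_deriv (by ring)⟩
      rw [one_mul, spow_of_pos h1]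
    refine ⟨ρ, hρ, b, hsys.isC0Regular hp Ioo_subset_Ioi_self isOpen_Ioo
      (fun r hr => (hab r hr).1.ne') le_rfl hb, ?_⟩
    have h1 := hsys.vanishingAtZero hp hNp hρ (by positivity) hb ha
    have h2 : ((θ * k) ^ (p - 1)) ^ (1 / (p - 1)) = θ * k := by
      rw [← Real.rpow_mul (by positivity), mul_one_div_cancel hp1.ne', Real.rpow_one]
    rw [h2, ← hθdef, mul_div_cancel_left₀ _ hθ.ne'] at h1
    exact h1
  · intro w₀ d hw₀ hd
    -- `s` is the sign of `d`, and `F = s b` with `b₀ = |d|^(p-1)`.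
    obtain ⟨s, hs, hsd⟩ : ∃ s : ℝ, (s = 1 ∨ s = -1) ∧ 0 < s * d := by
      rcases hd.lt_or_gt with h | h
      · exact ⟨-1, Or.inr rfl, by linarith⟩
      · exact ⟨1, Or.inl rfl, by linarith⟩
    have hb₀ : 0 < (s * d) ^ (p - 1) := by positivity
    obtain ⟨ρ, hρ, a, b, hab, ha, hb⟩ := exists_local_solution (e₁ := s) (e₂ := -ε * s) hθ hτ hm
      hq0 hw₀ hb₀.le hs (by rcases hε with rfl | rfl <;> rcases hs with rfl | rfl <;> norm_num)
      fun h => absurd h hb₀.ne'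
    have hspow : ∀ x : ℝ, 0 < x → spow m (s * x) = s * x ^ m := by
      intro x hx
      rcases hs with rfl | rfl
      · rw [one_mul, one_mul, spow_of_pos hx]
      · rw [neg_one_mul, spow_neg, spow_of_pos hx]; ring
    have hs2 : s * s = 1 := by rcases hs with rfl | rfl <;> norm_num
    have hsys : IsFluxSystem θ τ m q ε (Ioo 0 ρ) a (fun r => s * b r) := by
      intro r hr
      obtain ⟨h1, h2, h3, h4⟩ := hab r hr
      refine ⟨h1, h3.congr_deriv ?_, (h4.const_mul s).congr_deriv ?_⟩
      · beta_reduce; rw [hspow _ h2]; ring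
      · linear_combination (-ε * r ^ (τ - 1) * a r ^ q) * hs2
    have hs0 : s ≠ 0 := by rintro rfl; simp at hs2
    refine ⟨ρ, hρ, a, hsys.isC0Regular hp Ioo_subset_Ioi_self isOpen_Ioo
      (fun r hr => mul_ne_zero hs0 (hab r hr).2.1.ne') hw₀.le ha, ?_⟩
    have h1 := hsys.fluxAtZero hp hρ ha (hb.const_mul s)
    have h2 : ((s * d) ^ (p - 1)) ^ (1 / (p - 1)) = s * d := by
      rw [← Real.rpow_mul (by positivity), mul_one_div_cancel hp1.ne', Real.rpow_one]
    rw [← hmdef, hspow _ hb₀, h2, ← mul_assoc, hs2, one_mul] at h1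
    exact h1
  · intro ρ w hρ hw
    obtain ⟨c, hc, hlim⟩ := hw.exists_limit
    have hsys := hw.isPositiveSolution.isFluxSystem hp Ioo_subset_Ioi_self
    rcases hsys.trichotomy hθ hτ hm hq0 hmq hε hρ hc hlim with
      ⟨hc, hF⟩ | ⟨rfl, F₀, hF₀, hF⟩ | ⟨hc, F₀, hF₀, hF⟩
    · exact Or.inl ⟨c, hc, hsys.regularAtZero hp hq0 hτ hρ hε hc hlim hF⟩
    · refine Or.inr (Or.inl ⟨F₀ ^ m / θ, by positivity, ?_⟩)
      have := hsys.vanishingAtZero hp hNp hρ hF₀ hlim hF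
      simp only [mul_div_cancel₀ _ hθ.ne']
      exact this
    · exact Or.inr (Or.inr ⟨c, _, hc, spow_ne_zero hF₀, hsys.fluxAtZero hp hρ hlim hF⟩)

/-! ### Comparison principle, limits of derivatives, and a superlinear inequality. -/

/-- Two quantities whose derivatives are nonnegative as long as both are positive stay above
their initial values. -/
lemma le_of_cooperative {D E D' E' : ℝ → ℝ} {t₀ : ℝ} (hD : ∀ t, t₀ ≤ t → HasDerivAt D (D' t) t)
    (hE : ∀ t, t₀ ≤ t → HasDerivAt E (E' t) t) (hD₀ : 0 < D t₀) (hE₀ : 0 < E t₀)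
    (h : ∀ t, t₀ ≤ t → 0 < D t → 0 < E t → 0 ≤ D' t ∧ 0 ≤ E' t) {T : ℝ} (hT : t₀ ≤ T) :
    D t₀ ≤ D T ∧ E t₀ ≤ E T := by
  have hDc : ContinuousOn D (Icc t₀ T) := fun t ht => (hD t ht.1).continuousAt.continuousWithinAt
  have hEc : ContinuousOn E (Icc t₀ T) := fun t ht => (hE t ht.1).continuousAt.continuousWithinAt
  have hcl : IsClosed ({t | D t₀ ≤ D t ∧ E t₀ ≤ E t} ∩ Icc t₀ T) := by
    have h1 := hDc.preimage_isClosed_of_isClosed isClosed_Icc (isClosed_Ici (a := D t₀))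
    have h2 := hEc.preimage_isClosed_of_isClosed isClosed_Icc (isClosed_Ici (a := E t₀))
    convert h1.inter h2 using 1
    ext t
    simp only [mem_inter_iff, mem_ofPred_eq, mem_preimage, mem_Ici]
    tauto
  -- Continuous induction: where both inequalities hold, `D` and `E` are positive on a
  -- neighbourhood, so both are nondecreasing a little further to the right.
  refine hcl.Icc_subset_of_forall_mem_nhdsWithin ⟨le_rfl, le_rfl⟩ ?_ ⟨hT, le_rfl⟩
  rintro s ⟨⟨hs1, hs2⟩, hs0, hsT⟩
  have hpos : ∀ᶠ t in 𝓝 s, 0 < D t ∧ 0 < E t :=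
    ((hD s hs0).continuousAt.eventually_const_lt (hD₀.trans_le hs1)).and
      ((hE s hs0).continuousAt.eventually_const_lt (hE₀.trans_le hs2))
  obtain ⟨η, hη, hball⟩ := Metric.eventually_nhds_iff.1 hpos
  filter_upwards [Ioo_mem_nhdsGT (show s < s + η by linarith)] with t ht
  have hin : ∀ u ∈ Icc s t, 0 < D u ∧ 0 < E u := fun u hu => hball (by
    rw [Real.dist_eq, abs_lt]; constructor <;> linarith [hu.1, hu.2, ht.2])
  have mono : ∀ (G G' : ℝ → ℝ), (∀ t, t₀ ≤ t → HasDerivAt G (G' t) t) →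
      (∀ u ∈ Icc s t, 0 ≤ G' u) → G s ≤ G t := by
    intro G G' hG hG'
    refine monotoneOn_of_deriv_nonneg (convex_Icc s t)
      (fun u hu => (hG u (hs0.trans hu.1)).continuousAt.continuousWithinAt)
      (fun u hu => (hG u (hs0.trans
        (interior_subset hu).1)).differentiableAt.differentiableWithinAt) (fun u hu => ?_)
      ⟨le_rfl, ht.1.le⟩ ⟨ht.1.le, le_rfl⟩ ht.1.le
    rw [(hG u (hs0.trans (interior_subset hu).1)).deriv]
    exact hG' u (interior_subset hu)
  exact ⟨hs1.trans (mono D D' hD fun u hu => (h u (hs0.trans hu.1) (hin u hu).1 (hin u hu).2).1),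
    hs2.trans (mono E E' hE fun u hu => (h u (hs0.trans hu.1) (hin u hu).1 (hin u hu).2).2)⟩

lemma exists_neg_of_deriv_le_neg {g g' : ℝ → ℝ} {a c : ℝ} (hc : 0 < c)
    (hg : ∀ t, a ≤ t → HasDerivAt g (g' t) t) (hg' : ∀ t, a ≤ t → g' t ≤ -c) :
    ∃ t, a ≤ t ∧ g t < 0 := by
  have hanti : AntitoneOn (fun t => g t + c * t) (Ici a) :=
    antitoneOn_Ici_of_hasDerivAt (g' := fun t => g' t + c * 1)
      (fun t ht => (hg t ht).add ((hasDerivAt_id t).const_mul c))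
      (fun t ht => by linarith [hg' t ht])
  obtain ⟨t, ht1, ht2⟩ := (((tendsto_id.const_mul_atTop hc).eventually_gt_atTop
    (g a + c * a)).and (eventually_ge_atTop a)).exists
  refine ⟨t, ht2, ?_⟩
  have := hanti self_mem_Ici ht2 ht2
  simp only [id] at this ht1
  linarith

lemma eventually_gt_of_hasDerivAt_pos {g : ℝ → ℝ} {g' t : ℝ} (hg : HasDerivAt g g' t)
    (h : 0 < g') : ∀ᶠ s in 𝓝[>] t, g t < g s := by
  have h1 := (hasDerivAt_iff_tendsto_slope.1 hg).mono_left
    (nhdsWithin_mono t (fun s (hs : t < s) => hs.ne'))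
  filter_upwards [h1.eventually_const_lt h, self_mem_nhdsWithin] with s hs hts
  have hts : t < s := hts
  rw [slope_def_field, lt_div_iff₀ (by linarith)] at hs
  linarith

/-- If a function and its derivative converge at infinity, then the derivative tends to `0`. -/
lemma deriv_limit_eq_zero_atTop {g g' : ℝ → ℝ} {L l : ℝ} (hg : ∀ t, HasDerivAt g (g' t) t)
    (hL : Tendsto g atTop (𝓝 L)) (hl : Tendsto g' atTop (𝓝 l)) : l = 0 := by
  have h1 : ∀ t : ℝ, ∃ s, t < s ∧ g' s = g (t + 1) - g t := fun t => by
    obtain ⟨s, hs, h⟩ := exists_hasDerivAt_eq_slope g g' (lt_add_one t)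
      (fun u _ => (hg u).continuousAt.continuousWithinAt) (fun u _ => hg u)
    exact ⟨s, hs.1, by rw [h]; simp⟩
  choose ξ hξ1 hξ2 using h1
  have h2 : Tendsto ξ atTop atTop := tendsto_atTop_mono (fun t => (hξ1 t).le) tendsto_id
  have h3 : Tendsto (fun t => g (t + 1) - g t) atTop (𝓝 (L - L)) :=
    (hL.comp (tendsto_atTop_add_const_right _ 1 tendsto_id)).sub hL
  rw [sub_self] at h3
  exact tendsto_nhds_unique ((hl.comp h2).congr hξ2) h3

lemma deriv_limit_eq_zero_atBot {g g' : ℝ → ℝ} {L l : ℝ} (hg : ∀ t, HasDerivAt g (g' t) t)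
    (hL : Tendsto g atBot (𝓝 L)) (hl : Tendsto g' atBot (𝓝 l)) : l = 0 := by
  have h1 : ∀ t, HasDerivAt (fun t => g (-t)) (-g' (-t)) t := fun t => by
    exact ((hg (-t)).scomp t (hasDerivAt_neg t)).congr_deriv (by simp)
  have := deriv_limit_eq_zero_atTop h1 (hL.comp tendsto_neg_atTop_atBot)
    (hl.comp tendsto_neg_atTop_atBot).neg
  linarith

/-- `(x y)^e` as a weighted geometric mean of `y^m / x` and `x^q / y`. -/
lemma rpow_mul_eq_geom_mean {m q x y : ℝ} (hm : 0 < m) (hq : 0 < q) (hx : 0 < x) (hy : 0 < y) :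
    (x * y) ^ ((m * q - 1) / (q + m + 2)) =
      (y ^ m / x) ^ ((q + 1) / (q + m + 2)) * (x ^ q / y) ^ ((m + 1) / (q + m + 2)) := by
  have h1 : 0 < y ^ m / x := by positivity
  have h2 : 0 < x ^ q / y := by positivity
  have h3 : q + m + 2 ≠ 0 := by positivity
  rw [Real.rpow_def_of_pos (mul_pos hx hy), Real.rpow_def_of_pos h1, Real.rpow_def_of_pos h2,
    ← Real.exp_add, Real.log_mul hx.ne' hy.ne', Real.log_div (by positivity) hx.ne',
    Real.log_div (by positivity) hy.ne', Real.log_rpow hy, Real.log_rpow hx]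
  congr 1
  field_simp
  ring

/-- Weighted AM-GM. The weights are those for which the geometric mean depends on `x y` alone. It
turns the growth rates of the two components into a differential inequality for `(x y)^(-e)`, the
source of every blow-up argument below. -/
lemma rpow_mul_sub_one_le {m q x y : ℝ} (hm : 0 < m) (hq : 0 < q) (hx : 0 < x) (hy : 0 < y) :
    (x * y) ^ ((m * q - 1) / (q + m + 2)) ≤
      (q + 1) / (q + m + 2) * (y ^ m / x) + (m + 1) / (q + m + 2) * (x ^ q / y) := by
  rw [rpow_mul_eq_geom_mean hm hq hx hy]
  exact Real.geom_mean_le_arith_mean2_weighted (by positivity) (by positivity) (by positivity)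
    (by positivity) (by field_simp; ring)

/-! ### Orbits of the autonomous system. -/

/-- Solutions on the whole line of `x' = γ (x - y^m)`, `y' = δ (y - x^q)` in the open
positive quadrant. -/
def IsOrbit (γ δ m q : ℝ) (x y : ℝ → ℝ) : Prop :=
  ∀ t, 0 < x t ∧ 0 < y t ∧ HasDerivAt x (γ * (x t - y t ^ m)) t ∧
    HasDerivAt y (δ * (y t - x t ^ q)) t

namespace IsOrbit
variable {γ δ m q : ℝ} {x y : ℝ → ℝ}

lemma swap (h : IsOrbit γ δ m q x y) : IsOrbit δ γ q m y x := fun t =>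
  ⟨(h t).2.1, (h t).1, (h t).2.2.2, (h t).2.2.1⟩

/-- The defects `P = x - y^m` and `Q = y - x^q` satisfy a linear system with negative off-diagonal
coefficients. Hence `P` and `-Q` reinforce each other where they are positive. -/
lemma hasDerivAt_defect (h : IsOrbit γ δ m q x y) (t : ℝ) :
    HasDerivAt (fun t => x t - y t ^ m)
      (γ * (x t - y t ^ m) - m * δ * y t ^ (m - 1) * (y t - x t ^ q)) t := by
  obtain ⟨hx, hy, hdx, hdy⟩ := h t
  refine (hdx.sub (hdy.rpow_const (Or.inl hy.ne'))).congr_deriv ?_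
  ring

lemma continuous_fst (h : IsOrbit γ δ m q x y) : Continuous x :=
  continuous_iff_continuousAt.2 fun t => (h t).2.2.1.continuousAt

lemma continuous_snd (h : IsOrbit γ δ m q x y) : Continuous y := h.swap.continuous_fst

/-- By cooperation `Q` stays below its negative initial value, so `y' = δ Q` is bounded above by a
negative constant and `y` becomes negative. -/
lemma not_defects_opposite (hγ : 0 < γ) (hδ : 0 < δ) (hm : 0 < m) (hq : 0 < q)
    (h : IsOrbit γ δ m q x y) {t₀ : ℝ} (hP : 0 < x t₀ - y t₀ ^ m) (hQ : y t₀ - x t₀ ^ q < 0) :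
    False := by
  have key : ∀ t, t₀ ≤ t → -(y t₀ - x t₀ ^ q) ≤ -(y t - x t ^ q) := fun t ht =>
    (le_of_cooperative (fun t _ => h.hasDerivAt_defect t)
      (fun t _ => (h.swap.hasDerivAt_defect t).neg) hP (neg_pos.2 hQ) (fun t _ h1 h2 => by
        obtain ⟨hx, hy, -, -⟩ := h t
        have h3 : 0 < y t ^ (m - 1) := Real.rpow_pos_of_pos hy _
        have h4 : 0 < x t ^ (q - 1) := Real.rpow_pos_of_pos hx _
        have h5 : 0 < m * δ * y t ^ (m - 1) := by positivity
        have h6 : 0 < q * γ * x t ^ (q - 1) := by positivity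
        have h7 := mul_pos hγ h1
        have h8 := mul_pos hδ h2
        have h9 := mul_pos h5 h2
        have h10 := mul_pos h6 h1
        simp only [Pi.neg_apply] at h2 h8 h9
        constructor <;> linarith) ht).2
  obtain ⟨t, ht, hneg⟩ := exists_neg_of_deriv_le_neg (a := t₀) (c := δ * -(y t₀ - x t₀ ^ q))
    (mul_pos hδ (neg_pos.2 hQ)) (fun t _ => (h t).2.2.2) (fun t ht => by
      have := mul_le_mul_of_nonneg_left (key t ht) hδ.le
      linarith)
  exact absurd (h t).2.1 (by linarith)

/-- The boundary case of `not_defects_opposite`: if exactly one defect vanishes, its derivative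
pushes the orbit at once into the forbidden open region. -/
lemma defects_eq_zero (hγ : 0 < γ) (hδ : 0 < δ) (hm : 0 < m) (hq : 0 < q)
    (h : IsOrbit γ δ m q x y) {t : ℝ} (hP : 0 ≤ x t - y t ^ m) (hQ : y t - x t ^ q ≤ 0) :
    x t - y t ^ m = 0 ∧ y t - x t ^ q = 0 := by
  obtain ⟨hx, hy, -, -⟩ := h t
  have hPd := h.hasDerivAt_defect t
  have hQd := h.swap.hasDerivAt_defect t
  rcases hP.eq_or_lt with hP | hP <;> rcases hQ.eq_or_lt with hQ | hQ
  · exact ⟨hP.symm, hQ⟩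
  · exfalso
    have h1 : 0 < m * δ * y t ^ (m - 1) * -(y t - x t ^ q) :=
      mul_pos (by positivity) (neg_pos.2 hQ)
    obtain ⟨s, hs1, hs2⟩ := ((eventually_gt_of_hasDerivAt_pos hPd (by rw [← hP]; linarith)).and
      ((hQd.continuousAt.tendsto.mono_left nhdsWithin_le_nhds).eventually_lt_const hQ)).exists
    exact h.not_defects_opposite hγ hδ hm hq (by rwa [← hP] at hs1) hs2
  · exfalso
    have h1 : 0 < q * γ * x t ^ (q - 1) * (x t - y t ^ m) := mul_pos (by positivity) hP
    obtain ⟨s, hs1, hs2⟩ := ((eventually_gt_of_hasDerivAt_pos hQd.neg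
      (by rw [hQ]; linarith)).and
      ((hPd.continuousAt.tendsto.mono_left nhdsWithin_le_nhds).eventually_const_lt hP)).exists
    simp only [Pi.neg_apply] at hs1
    exact h.not_defects_opposite hγ hδ hm hq hs2 (by linarith)
  · exact (h.not_defects_opposite hγ hδ hm hq hP hQ).elim

lemma eq_one_of_fixed {x y : ℝ} (hmq : 1 < m * q) (hx : 0 < x)
    (hP : x = y ^ m) (hQ : y = x ^ q) : x = 1 ∧ y = 1 := by
  have h1 : x = x ^ (q * m) := by rw [Real.rpow_mul hx.le, ← hQ]; exact hP
  have h2 : Real.log x = q * m * Real.log x := by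
    conv_lhs => rw [h1]
    exact Real.log_rpow hx _
  have h3 : Real.log x = 0 := by
    have : (m * q - 1) * Real.log x = 0 := by linarith
    exact (mul_eq_zero.1 this).resolve_left (by linarith)
  have h4 : x = 1 := Real.eq_one_of_pos_of_log_eq_zero hx h3
  exact ⟨h4, by rw [hQ, h4, Real.one_rpow]⟩

/-- An orbit through the equilibrium `(1, 1)` is constant. -/
lemma eq_one (h : IsOrbit γ δ m q x y) {t₀ : ℝ} (hx : x t₀ = 1) (hy : y t₀ = 1) (t : ℝ) :
    x t = 1 ∧ y t = 1 := by
  set V : ℝ × ℝ → ℝ × ℝ := fun z => (γ * (z.1 - z.2 ^ m), δ * (z.2 - z.1 ^ q)) with hV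
  have hVc : ContDiffAt ℝ 1 V (1, 1) := by
    refine ContDiffAt.prodMk ?_ ?_
    · exact contDiffAt_const.mul (contDiffAt_fst.sub
        (contDiffAt_snd.rpow_const_of_ne (by norm_num)))
    · exact contDiffAt_const.mul (contDiffAt_snd.sub
        (contDiffAt_fst.rpow_const_of_ne (by norm_num)))
  obtain ⟨K, s, hs, hLip⟩ := hVc.exists_lipschitzOnWith
  have hc : Continuous fun t => (x t, y t) := h.continuous_fst.prodMk h.continuous_snd
  -- The vector field need not be Lipschitz up to the axes, but it is so near `(1,1)`. Local
  -- uniqueness makes the set of times spent at the equilibrium open, and connectedness of the line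
  -- concludes.
  have hclopen : IsClopen {t | (x t, y t) = (1, 1)} := by
    refine ⟨isClosed_eq hc continuous_const, isOpen_iff_mem_nhds.2 fun t ht => ?_⟩
    have ht : (x t, y t) = (1, 1) := ht
    refine ODE_solution_unique_of_eventually (v := fun _ => V) (s := fun _ => s) (K := K)
      (Eventually.of_forall fun _ => hLip) ?_ ?_ ht
    · filter_upwards [hc.continuousAt.preimage_mem_nhds (by rw [ht]; exact hs)] with u hu
      exact ⟨(h u).2.2.1.prodMk (h u).2.2.2, hu⟩
    · refine Eventually.of_forall fun u => ⟨?_, mem_of_mem_nhds hs⟩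
      have : V (1, 1) = 0 := by simp [hV]
      rw [this]
      exact hasDerivAt_const u _
  have huniv := hclopen.eq_univ ⟨t₀, by simp [hx, hy]⟩
  have : t ∈ {t | (x t, y t) = (1, 1)} := huniv ▸ mem_univ t
  simpa using this

/-- Off the equilibrium both defects are nonzero with a common sign, and by the intermediate value
theorem this sign cannot change. -/
lemma trichotomy (hγ : 0 < γ) (hδ : 0 < δ) (hm : 0 < m) (hq : 0 < q) (hmq : 1 < m * q)
    (h : IsOrbit γ δ m q x y) :
    (∀ t, x t = 1 ∧ y t = 1) ∨ (∀ t, 0 < x t - y t ^ m ∧ 0 < y t - x t ^ q) ∨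
      ∀ t, x t - y t ^ m < 0 ∧ y t - x t ^ q < 0 := by
  by_cases hex : ∃ t, x t - y t ^ m = 0 ∧ y t - x t ^ q = 0
  · obtain ⟨t, hP, hQ⟩ := hex
    have := eq_one_of_fixed hmq (h t).1 (by linarith) (by linarith)
    exact Or.inl (h.eq_one this.1 this.2)
  push Not at hex
  have hsame : ∀ t, (0 < x t - y t ^ m ∧ 0 < y t - x t ^ q) ∨
      (x t - y t ^ m < 0 ∧ y t - x t ^ q < 0) := by
    intro t
    rcases lt_or_ge 0 (x t - y t ^ m) with hP | hP <;>
      rcases lt_or_ge 0 (y t - x t ^ q) with hQ | hQ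
    · exact Or.inl ⟨hP, hQ⟩
    · have := h.defects_eq_zero hγ hδ hm hq hP.le hQ
      exact absurd this.2 (hex t this.1)
    · have := h.swap.defects_eq_zero hδ hγ hq hm hQ.le hP
      exact absurd this.1 (hex t this.2)
    · refine Or.inr ⟨lt_of_le_of_ne hP fun h0 => ?_, lt_of_le_of_ne hQ fun h0 => ?_⟩
      · exact absurd (h.defects_eq_zero hγ hδ hm hq h0.ge hQ).2 (hex t h0)
      · have := h.swap.defects_eq_zero hδ hγ hq hm h0.ge hP
        exact absurd this.1 (hex t this.2)
  have hPc : Continuous fun t => x t - y t ^ m :=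
    continuous_iff_continuousAt.2 fun t => (h.hasDerivAt_defect t).continuousAt
  rcases hsame 0 with h0 | h0
  · refine Or.inr (Or.inl fun t => (hsame t).resolve_right fun ht => ?_)
    obtain ⟨s, hs⟩ := mem_range_of_exists_le_of_exists_ge hPc ⟨t, ht.1.le⟩ ⟨0, h0.1.le⟩
    rcases hsame s with hs' | hs' <;> linarith [hs'.1]
  · refine Or.inr (Or.inr fun t => (hsame t).resolve_left fun ht => ?_)
    obtain ⟨s, hs⟩ := mem_range_of_exists_le_of_exists_ge hPc ⟨0, h0.1.le⟩ ⟨t, ht.1.le⟩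
    rcases hsame s with hs' | hs' <;> linarith [hs'.1]

lemma hasDerivAt_rpow_mul (h : IsOrbit γ δ m q x y) (e t : ℝ) :
    HasDerivAt (fun t => (x t * y t) ^ e)
      (e * (x t * y t) ^ e * (γ * (1 - y t ^ m / x t) + δ * (1 - x t ^ q / y t))) t := by
  obtain ⟨hx, hy, hdx, hdy⟩ := h t
  refine ((hdx.mul hdy).rpow_const (Or.inl (mul_pos hx hy).ne')).congr_deriv ?_
  simp only [Pi.mul_apply]
  rw [Real.rpow_sub_one (mul_pos hx hy).ne']
  field_simp

/-- No orbit stays in the region where both components decrease. -/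
lemma not_both_decreasing (hγ : 0 < γ) (hδ : 0 < δ) (hm : 0 < m) (hq : 0 < q) (hmq : 1 < m * q)
    (h : IsOrbit γ δ m q x y) (hdec : ∀ t, x t - y t ^ m < 0 ∧ y t - x t ^ q < 0) : False := by
  set e := (m * q - 1) / (q + m + 2) with he
  have he0 : 0 < e := div_pos (by linarith) (by positivity)
  have hρ : ∀ t, 1 < y t ^ m / x t := fun t => by
    rw [one_lt_div (h t).1]; linarith [(hdec t).1]
  have hκ : ∀ t, 1 < x t ^ q / y t := fun t => by
    rw [one_lt_div (h t).2.1]; linarith [(hdec t).2]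
  have hf1 : ∀ t, 1 < (x t * y t) ^ e := fun t => by
    rw [he, rpow_mul_eq_geom_mean hm hq (h t).1 (h t).2.1]
    exact one_lt_mul_of_lt_of_le (Real.one_lt_rpow (hρ t) (by positivity))
      (Real.one_lt_rpow (hκ t) (by positivity)).le
  set c := e * min γ δ with hc
  have hc0 : 0 < c := mul_pos he0 (lt_min hγ hδ)
  -- In reversed time `g = (x y)^(-e)` satisfies `g < 1` and `g' ≤ -c (1 - g)`. So `g` decreases at
  -- a rate bounded away from `0` and becomes negative, which is impossible.
  have hg : ∀ t, HasDerivAt (fun t => (x (-t) * y (-t)) ^ (-e))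
      (-e * (x (-t) * y (-t)) ^ (-e) * (γ * (y (-t) ^ m / x (-t) - 1)
        + δ * (x (-t) ^ q / y (-t) - 1))) t := by
    intro t
    refine ((h.hasDerivAt_rpow_mul (-e) (-t)).scomp t (hasDerivAt_neg t)).congr_deriv ?_
    simp only [smul_eq_mul]
    ring
  have hg' : ∀ t, -e * (x (-t) * y (-t)) ^ (-e) * (γ * (y (-t) ^ m / x (-t) - 1)
        + δ * (x (-t) ^ q / y (-t) - 1)) ≤ -(c * (1 - (x (-t) * y (-t)) ^ (-e))) := by
    intro t
    have hxy : 0 < x (-t) * y (-t) := mul_pos (h _).1 (h _).2.1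
    have hf := hf1 (-t)
    have hm1 := rpow_mul_sub_one_le hm hq (h (-t)).1 (h (-t)).2.1
    have hρt := hρ (-t)
    have hκt := hκ (-t)
    rw [Real.rpow_neg hxy.le]
    rw [← he] at hm1
    set f := (x (-t) * y (-t)) ^ e
    set R := y (-t) ^ m / x (-t)
    set k := x (-t) ^ q / y (-t)
    have h1 : f - 1 ≤ (R - 1) + (k - 1) := by
      have ha : (q + 1) / (q + m + 2) ≤ 1 := by rw [div_le_one (by positivity)]; linarith
      have hb : (m + 1) / (q + m + 2) ≤ 1 := by rw [div_le_one (by positivity)]; linarith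
      have hab : (q + 1) / (q + m + 2) + (m + 1) / (q + m + 2) = 1 := by field_simp; ring
      nlinarith
    have h2 : min γ δ * (f - 1) ≤ γ * (R - 1) + δ * (k - 1) := by
      have h3 : min γ δ * (R - 1) ≤ γ * (R - 1) :=
        mul_le_mul_of_nonneg_right (min_le_left _ _) (by linarith)
      have h4 : min γ δ * (k - 1) ≤ δ * (k - 1) :=
        mul_le_mul_of_nonneg_right (min_le_right _ _) (by linarith)
      nlinarith [lt_min hγ hδ]
    have hf0 : 0 < f := by linarith
    have h5 : c * (1 - f⁻¹) = e * f⁻¹ * (min γ δ * (f - 1)) := by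
      rw [hc]; field_simp
    rw [h5]
    have := mul_le_mul_of_nonneg_left h2 (show 0 ≤ e * f⁻¹ by positivity)
    linarith
  have hlt1 : ∀ t, (x (-t) * y (-t)) ^ (-e) < 1 := fun t => by
    rw [Real.rpow_neg (mul_pos (h _).1 (h _).2.1).le]
    exact inv_lt_one_of_one_lt₀ (hf1 _)
  have hanti : AntitoneOn (fun t => (x (-t) * y (-t)) ^ (-e)) (Ici 0) :=
    antitoneOn_Ici_of_hasDerivAt (fun t _ => hg t) fun t _ => (hg' t).trans (by
      have := hlt1 t
      have := mul_pos hc0 (show 0 < 1 - (x (-t) * y (-t)) ^ (-e) by linarith)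
      linarith)
  obtain ⟨t, -, hneg⟩ := exists_neg_of_deriv_le_neg (a := 0)
    (c := c * (1 - (x (-0) * y (-0)) ^ (-e))) (mul_pos hc0 (by linarith [hlt1 0]))
    (fun t _ => hg t) (fun t ht => (hg' t).trans (by
      have := hanti self_mem_Ici ht ht
      simp only at this
      nlinarith))
  exact absurd (Real.rpow_pos_of_pos (mul_pos (h (-t)).1 (h (-t)).2.1) (-e)) (by linarith)

/-- An orbit is the equilibrium or stays in the region where both components increase. -/
theorem dichotomy (hγ : 0 < γ) (hδ : 0 < δ) (hm : 0 < m) (hq : 0 < q) (hmq : 1 < m * q)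
    (h : IsOrbit γ δ m q x y) :
    (∀ t, x t = 1 ∧ y t = 1) ∨ (∀ t, 0 < x t - y t ^ m ∧ 0 < y t - x t ^ q) := by
  rcases h.trichotomy hγ hδ hm hq hmq with h1 | h1 | h1
  · exact Or.inl h1
  · exact Or.inr h1
  · exact (h.not_both_decreasing hγ hδ hm hq hmq h1).elim

lemma strictMono_fst (hγ : 0 < γ) (h : IsOrbit γ δ m q x y)
    (hinc : ∀ t, 0 < x t - y t ^ m ∧ 0 < y t - x t ^ q) : StrictMono x :=
  strictMono_of_deriv_pos fun t => by
    rw [(h t).2.2.1.deriv]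
    exact mul_pos hγ (hinc t).1

/-- If `x ≥ 1`, then `y > x^q` gives `y^m > x^(m q) ≥ x`, against `x > y^m`. -/
lemma fst_lt_one (hm : 0 < m) (hmq : 1 < m * q) (h : IsOrbit γ δ m q x y)
    (hinc : ∀ t, 0 < x t - y t ^ m ∧ 0 < y t - x t ^ q) (t : ℝ) : x t < 1 := by
  obtain ⟨hx, hy, -, -⟩ := h t
  by_contra! hge
  have h1 : (x t ^ q) ^ m < y t ^ m :=
    Real.rpow_lt_rpow (by positivity) (by linarith [(hinc t).2]) hm
  rw [← Real.rpow_mul hx.le] at h1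
  have h2 : x t ^ (1 : ℝ) ≤ x t ^ (q * m) := Real.rpow_le_rpow_of_exponent_le hge (by linarith)
  rw [Real.rpow_one] at h2
  linarith [(hinc t).1]

/-- Both components are increasing and bounded by `1`. Their derivatives converge too, necessarily
to `0`, so the limit is an equilibrium with positive first component. -/
lemma tendsto_atTop (hγ : 0 < γ) (hδ : 0 < δ) (hm : 0 < m) (hq : 0 < q) (hmq : 1 < m * q)
    (h : IsOrbit γ δ m q x y) (hinc : ∀ t, 0 < x t - y t ^ m ∧ 0 < y t - x t ^ q) :
    Tendsto x atTop (𝓝 1) := by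
  have hinc' : ∀ t, 0 < y t - x t ^ q ∧ 0 < x t - y t ^ m := fun t => (hinc t).symm
  have hX := tendsto_atTop_ciSup (h.strictMono_fst hγ hinc).monotone
    ⟨1, by rintro _ ⟨t, rfl⟩; exact (h.fst_lt_one hm hmq hinc t).le⟩
  have hY := tendsto_atTop_ciSup (h.swap.strictMono_fst hδ hinc').monotone
    ⟨1, by rintro _ ⟨t, rfl⟩
           exact (h.swap.fst_lt_one hq (by linarith) hinc' t).le⟩
  set X := ⨆ t, x t
  set Y := ⨆ t, y t
  have hX0 : 0 < X := (h 0).1.trans_le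
    ((h.strictMono_fst hγ hinc).monotone.ge_of_tendsto hX 0)
  have h1 := deriv_limit_eq_zero_atTop (fun t => (h t).2.2.1) hX
    ((hX.sub (hY.rpow_const (Or.inr hm.le))).const_mul γ)
  have h2 := deriv_limit_eq_zero_atTop (fun t => (h t).2.2.2) hY
    ((hY.sub (hX.rpow_const (Or.inr hq.le))).const_mul δ)
  have h3 := (mul_eq_zero.1 h1).resolve_left hγ.ne'
  have h4 := (mul_eq_zero.1 h2).resolve_left hδ.ne'
  rw [(eq_one_of_fixed hmq hX0 (by linarith) (by linarith)).1] at hX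
  exact hX

lemma tendsto_atBot (hγ : 0 < γ) (hδ : 0 < δ) (hm : 0 < m) (hq : 0 < q) (hmq : 1 < m * q)
    (h : IsOrbit γ δ m q x y) (hinc : ∀ t, 0 < x t - y t ^ m ∧ 0 < y t - x t ^ q) :
    Tendsto x atBot (𝓝 0) ∧ Tendsto y atBot (𝓝 0) := by
  have hinc' : ∀ t, 0 < y t - x t ^ q ∧ 0 < x t - y t ^ m := fun t => (hinc t).symm
  have hX := tendsto_atBot_ciInf (h.strictMono_fst hγ hinc).monotone
    ⟨0, by rintro _ ⟨t, rfl⟩; exact (h t).1.le⟩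
  have hY := tendsto_atBot_ciInf (h.swap.strictMono_fst hδ hinc').monotone
    ⟨0, by rintro _ ⟨t, rfl⟩; exact (h t).2.1.le⟩
  set X := ⨅ t, x t
  set Y := ⨅ t, y t
  have hX0 : 0 ≤ X := ge_of_tendsto' hX fun t => (h t).1.le
  have hX1 : X < 1 := lt_of_le_of_lt
    ((h.strictMono_fst hγ hinc).monotone.le_of_tendsto hX 0) (h.fst_lt_one hm hmq hinc 0)
  have h1 := deriv_limit_eq_zero_atBot (fun t => (h t).2.2.1) hX
    ((hX.sub (hY.rpow_const (Or.inr hm.le))).const_mul γ)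
  have h2 := deriv_limit_eq_zero_atBot (fun t => (h t).2.2.2) hY
    ((hY.sub (hX.rpow_const (Or.inr hq.le))).const_mul δ)
  have h3 := (mul_eq_zero.1 h1).resolve_left hγ.ne'
  have h4 := (mul_eq_zero.1 h2).resolve_left hδ.ne'
  rcases hX0.eq_or_lt with h0 | h0
  · have hY0 : Y = 0 := by rw [← h0, Real.zero_rpow hq.ne'] at h4; linarith
    rw [← h0] at hX
    rw [hY0] at hY
    exact ⟨hX, hY⟩
  · exact absurd (eq_one_of_fixed hmq h0 (by linarith) (by linarith)).1 hX1.ne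

/-- The ratios `R = y^m/x` and `k = x^q/y` form a Lotka-Volterra system with linear growth rates `m
δ - γ` and `q γ - δ`, that is `θ` and `τ` in the application. -/
lemma hasDerivAt_ratio (h : IsOrbit γ δ m q x y) (t : ℝ) :
    HasDerivAt (fun t => y t ^ m / x t) (y t ^ m / x t *
      ((m * δ - γ) + γ * (y t ^ m / x t) - m * δ * (x t ^ q / y t))) t := by
  obtain ⟨hx, hy, hdx, hdy⟩ := h t
  refine ((hdy.rpow_const (Or.inl hy.ne')).div hdx hx.ne').congr_deriv ?_
  rw [Real.rpow_sub_one hy.ne']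
  field_simp
  ring

/-- An orbit which tends to `0` at `-∞` does so like `e^(γ t)`. -/
theorem exists_limit_exp_mul (hγ : 0 < γ) (hδ : 0 < δ) (hm : 0 < m) (hq : 0 < q)
    (hmq : 1 < m * q) (hθ : 0 < m * δ - γ) (hτ : 0 < q * γ - δ) (h : IsOrbit γ δ m q x y)
    (hx0 : Tendsto x atBot (𝓝 0)) (hy0 : Tendsto y atBot (𝓝 0)) :
    ∃ u₀, 0 < u₀ ∧ Tendsto (fun t => Real.exp (-γ * t) * x t) atBot (𝓝 u₀) := by
  set e := (m * q - 1) / (q + m + 2) with he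
  have he0 : 0 < e := div_pos (by linarith) (by positivity)
  set S : ℝ → ℝ := fun t => y t ^ m / x t + x t ^ q / y t with hS
  have hR : ∀ t, 0 < y t ^ m / x t := fun t => by
    have := (h t).1; have := (h t).2.1; positivity
  have hk : ∀ t, 0 < x t ^ q / y t := fun t => by
    have := (h t).1; have := (h t).2.1; positivity
  have hS0 : ∀ t, 0 < S t := fun t => add_pos (hR t) (hk t)
  -- `R k` is the smaller ratio times the larger one; the smaller is at most the weighted geometric
  -- mean `(x y)^e`, the larger at most `S`.
  have hmin : ∀ t, y t ^ m / x t * (x t ^ q / y t) ≤ (x t * y t) ^ e * S t := by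
    intro t
    rw [he, rpow_mul_eq_geom_mean hm hq (h t).1 (h t).2.1]
    have hR := hR t
    have hk := hk t
    simp only [hS]
    set R := y t ^ m / x t
    set k := x t ^ q / y t
    have hsum : (q + 1) / (q + m + 2) + (m + 1) / (q + m + 2) = 1 := by field_simp; ring
    have hM : min R k ≤ R ^ ((q + 1) / (q + m + 2)) * k ^ ((m + 1) / (q + m + 2)) := by
      have h0 : 0 < min R k := lt_min hR hk
      calc min R k = min R k ^ ((q + 1) / (q + m + 2)) * min R k ^ ((m + 1) / (q + m + 2)) := by
            rw [← Real.rpow_add h0, hsum, Real.rpow_one]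
        _ ≤ _ := mul_le_mul
            (Real.rpow_le_rpow h0.le (min_le_left _ _) (by positivity))
            (Real.rpow_le_rpow h0.le (min_le_right _ _) (by positivity)) (by positivity)
            (by positivity)
    refine le_trans ?_ (mul_le_mul_of_nonneg_right hM (by positivity))
    rcases le_total R k with hle | hle
    · rw [min_eq_left hle]; nlinarith
    · rw [min_eq_right hle]; nlinarith
  set c := min (m * δ - γ) (q * γ - δ) / 2 with hc
  have hc0 : 0 < c := half_pos (lt_min hθ hτ)
  have hflim : Tendsto (fun t => (m * δ + q * γ) * (x t * y t) ^ e) atBot (𝓝 0) := by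
    have := ((hx0.mul hy0).rpow_const (p := e) (Or.inr he0.le)).const_mul (m * δ + q * γ)
    simpa [Real.zero_rpow he0.ne'] using this
  obtain ⟨T, hT⟩ := eventually_atBot.1 (hflim.eventually_lt_const hc0)
  -- The only negative term of `S'` is `-(m δ + q γ) R k`. Near `-∞`, where `x y → 0`, it is
  -- absorbed by half of the linear growth, so `S' ≥ c S` and `S` decays exponentially backward in
  -- time.
  have hSd : ∀ t, ∃ S', HasDerivAt S S' t ∧ (t ≤ T → c * S t ≤ S') := by
    intro t
    refine ⟨_, (h.hasDerivAt_ratio t).add (h.swap.hasDerivAt_ratio t), fun ht => ?_⟩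
    have h1 := hmin t
    have h2 := hT t ht
    have hR := hR t
    have hk := hk t
    have h3 := mul_le_mul_of_nonneg_right h2.le (hS0 t).le
    have h4 : 0 < m * δ + q * γ := by positivity
    have h5 := mul_le_mul_of_nonneg_left h1 h4.le
    have h6 : 2 * c ≤ m * δ - γ := by rw [hc]; linarith [min_le_left (m * δ - γ) (q * γ - δ)]
    have h7 : 2 * c ≤ q * γ - δ := by rw [hc]; linarith [min_le_right (m * δ - γ) (q * γ - δ)]
    simp only [hS] at h3 h5 ⊢
    set R := y t ^ m / x t
    set k := x t ^ q / y t
    have h8 := mul_le_mul_of_nonneg_right h6 hR.le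
    have h9 := mul_le_mul_of_nonneg_right h7 hk.le
    have h10 : 0 ≤ γ * R ^ 2 := by positivity
    have h11 : 0 ≤ δ * k ^ 2 := by positivity
    nlinarith
  choose S' hSd hSineq using hSd
  have mono : ∀ (G G' : ℝ → ℝ), (∀ t, HasDerivAt G (G' t) t) → (∀ t, t ≤ T → 0 ≤ G' t) →
      ∀ t, t ≤ T → G t ≤ G T := by
    intro G G' hG hG' t ht
    refine monotoneOn_of_deriv_nonneg (convex_Iic T)
      (fun u _ => (hG u).continuousAt.continuousWithinAt)
      (fun u _ => (hG u).differentiableAt.differentiableWithinAt) (fun u hu => ?_)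
      ht (mem_Iic.2 le_rfl) ht
    rw [(hG u).deriv]
    exact hG' u (by simpa using interior_subset hu)
  have hexp : ∀ c t : ℝ, HasDerivAt (fun t => Real.exp (c * t)) (Real.exp (c * t) * c) t := by
    intro c t
    simpa using ((hasDerivAt_id t).const_mul c).exp
  have hSexp : ∀ t, t ≤ T → S t ≤ S T * Real.exp (-c * T) * Real.exp (c * t) := by
    intro t ht
    have := mono (fun t => S t * Real.exp (-c * t)) _ (fun t => (hSd t).mul (hexp (-c) t))
      (fun t ht => by
        have := mul_nonneg (sub_nonneg.2 (hSineq t ht)) (Real.exp_pos (-c * t)).le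
        linarith) t ht
    have h2 : S t = S t * Real.exp (-c * t) * Real.exp (c * t) := by
      rw [mul_assoc, ← Real.exp_add]; simp
    rw [h2]
    exact mul_le_mul_of_nonneg_right this (Real.exp_pos _).le
  set C := S T * Real.exp (-c * T) with hC
  have hC0 : 0 < C := mul_pos (hS0 T) (Real.exp_pos _)
  -- `log x - γ t` has derivative `-γ R`, with `R` now integrable at `-∞`. It is therefore monotone
  -- and bounded there.
  have hlog : ∀ t, HasDerivAt (fun t => Real.log (x t) - γ * t) (-(γ * (y t ^ m / x t))) t := by
    intro t
    refine (((h t).2.2.1.log (h t).1.ne').sub ((hasDerivAt_id t).const_mul γ)).congr_deriv ?_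
    have := (h t).1.ne'
    field_simp
    ring
  have hbound : ∀ t, t ≤ T → Real.log (x t) - γ * t ≤
      Real.log (x T) - γ * T + γ * C / c * Real.exp (c * T) := by
    intro t ht
    have := mono (fun t => (Real.log (x t) - γ * t) + γ * C / c * Real.exp (c * t)) _
      (fun t => (hlog t).add ((hexp c t).const_mul _)) (fun t ht => by
        have h1 := hSexp t ht
        have h2 : y t ^ m / x t ≤ S t := by have := hk t; simp only [hS]; linarith
        have h3 := mul_le_mul_of_nonneg_left (h2.trans h1) hγ.le
        have h4 : γ * C / c * (Real.exp (c * t) * c) = γ * (C * Real.exp (c * t)) := by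
          field_simp
        linarith) t ht
    have h5 : 0 ≤ γ * C / c * Real.exp (c * t) := by positivity
    linarith
  have hu : ∀ t, Real.exp (-γ * t) * x t = Real.exp (Real.log (x t) - γ * t) := by
    intro t
    rw [sub_eq_add_neg, Real.exp_add, Real.exp_log (h t).1, mul_comm, neg_mul]
  have hanti : Antitone fun t => Real.log (x t) - γ * t :=
    antitone_of_deriv_nonpos (fun t => (hlog t).differentiableAt) fun t => by
      rw [(hlog t).deriv]
      have := mul_pos hγ (hR t)
      linarith
  have hlim := tendsto_atBot_ciSup hanti
    ⟨Real.log (x T) - γ * T + γ * C / c * Real.exp (c * T), by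
      rintro _ ⟨t, rfl⟩
      rcases le_total t T with ht | ht
      · exact hbound t ht
      · have h5 : 0 ≤ γ * C / c * Real.exp (c * T) := by positivity
        linarith [hanti ht]⟩
  exact ⟨_, Real.exp_pos _, ((Real.continuous_exp.tendsto _).comp hlim).congr fun t =>
    (hu t).symm⟩

end IsOrbit

/-! ### Integral form of the system and monotone iteration. -/

/-- The bounded solution of `X' = γ (X - g)` for a bounded function `g`. -/
noncomputable def tailMean (γ : ℝ) (g : ℝ → ℝ) (t : ℝ) : ℝ :=
  Real.exp (γ * t) * ∫ s in Ioi t, γ * Real.exp (-γ * s) * g s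

section
open MeasureTheory
variable {γ : ℝ} {g h X X' : ℝ → ℝ}

lemma integrableOn_exp_mul (hγ : 0 < γ) (hg : Measurable g) (hg01 : ∀ s, g s ∈ Icc 0 1) (t : ℝ) :
    IntegrableOn (fun s => γ * Real.exp (-γ * s) * g s) (Ioi t) := by
  refine Integrable.mono' ((integrableOn_exp_mul_Ioi (neg_lt_zero.2 hγ) t).const_mul γ)
    (by fun_prop) (Eventually.of_forall fun s => ?_)
  have h1 : 0 < γ * Real.exp (-γ * s) := mul_pos hγ (Real.exp_pos _)
  have h2 := hg01 s
  rw [Real.norm_eq_abs, abs_of_nonneg (mul_nonneg h1.le h2.1)]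
  exact mul_le_of_le_one_right h1.le h2.2

lemma integral_exp_mul_mono (hγ : 0 < γ) (hg : Measurable g) (hg01 : ∀ s, g s ∈ Icc 0 1)
    (hh : Measurable h) (hh01 : ∀ s, h s ∈ Icc 0 1) (hle : ∀ s, g s ≤ h s) (t : ℝ) :
    ∫ s in Ioi t, γ * Real.exp (-γ * s) * g s ≤ ∫ s in Ioi t, γ * Real.exp (-γ * s) * h s :=
  integral_mono (integrableOn_exp_mul hγ hg hg01 t) (integrableOn_exp_mul hγ hh hh01 t)
    fun s => mul_le_mul_of_nonneg_left (hle s) (mul_pos hγ (Real.exp_pos _)).le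

lemma integral_exp_mul_one (hγ : 0 < γ) (t : ℝ) :
    ∫ s in Ioi t, γ * Real.exp (-γ * s) * (1 : ℝ) = Real.exp (-γ * t) := by
  simp only [mul_one]
  rw [integral_const_mul, integral_exp_mul_Ioi (neg_lt_zero.2 hγ)]
  field_simp

lemma integral_exp_mul_mem (hγ : 0 < γ) (hg : Measurable g) (hg01 : ∀ s, g s ∈ Icc 0 1) (t : ℝ) :
    ∫ s in Ioi t, γ * Real.exp (-γ * s) * g s ∈ Icc 0 (Real.exp (-γ * t)) := by
  constructor
  · exact integral_nonneg fun s => mul_nonneg (mul_pos hγ (Real.exp_pos _)).le (hg01 s).1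
  · rw [← integral_exp_mul_one hγ]
    exact integral_exp_mul_mono hγ hg hg01 measurable_const (fun _ => ⟨zero_le_one, le_rfl⟩)
      (fun s => (hg01 s).2) t

lemma tailMean_mono (hγ : 0 < γ) (hg : Measurable g) (hg01 : ∀ s, g s ∈ Icc 0 1)
    (hh : Measurable h) (hh01 : ∀ s, h s ∈ Icc 0 1) (hle : ∀ s, g s ≤ h s) (t : ℝ) :
    tailMean γ g t ≤ tailMean γ h t :=
  mul_le_mul_of_nonneg_left (integral_exp_mul_mono hγ hg hg01 hh hh01 hle t) (Real.exp_pos _).le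

lemma integral_Ioi_eq_sub (hγ : 0 < γ) (hg : Measurable g) (hg01 : ∀ s, g s ∈ Icc 0 1) (t : ℝ) :
    ∫ s in Ioi t, γ * Real.exp (-γ * s) * g s = (∫ s in Ioi (0 : ℝ), γ * Real.exp (-γ * s) * g s)
      - ∫ s in (0 : ℝ)..t, γ * Real.exp (-γ * s) * g s := by
  rw [← intervalIntegral.integral_Ioi_sub_Ioi' (integrableOn_exp_mul hγ hg hg01 0)
    (integrableOn_exp_mul hγ hg hg01 t)]
  ring

lemma intervalIntegrable_exp_mul (hγ : 0 < γ) (hg : Measurable g) (hg01 : ∀ s, g s ∈ Icc 0 1)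
    (a b : ℝ) : IntervalIntegrable (fun s => γ * Real.exp (-γ * s) * g s) volume a b :=
  ⟨(integrableOn_exp_mul hγ hg hg01 a).mono_set Ioc_subset_Ioi_self,
    (integrableOn_exp_mul hγ hg hg01 b).mono_set Ioc_subset_Ioi_self⟩

lemma continuous_tailMean (hγ : 0 < γ) (hg : Measurable g) (hg01 : ∀ s, g s ∈ Icc 0 1) :
    Continuous (tailMean γ g) := by
  have : tailMean γ g = fun t => Real.exp (γ * t) * ((∫ s in Ioi (0 : ℝ), γ * Real.exp (-γ * s) * g s)
      - ∫ s in (0 : ℝ)..t, γ * Real.exp (-γ * s) * g s) := by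
    ext t; rw [tailMean, integral_Ioi_eq_sub hγ hg hg01]
  rw [this]
  exact (by fun_prop : Continuous fun t : ℝ => Real.exp (γ * t)).mul (continuous_const.sub
    (intervalIntegral.continuous_primitive (intervalIntegrable_exp_mul hγ hg hg01) 0))

lemma hasDerivAt_integral_exp_mul (hγ : 0 < γ) (hg : Continuous g) (hg01 : ∀ s, g s ∈ Icc 0 1)
    (t : ℝ) : HasDerivAt (fun t => ∫ s in Ioi t, γ * Real.exp (-γ * s) * g s)
      (-(γ * Real.exp (-γ * t) * g t)) t := by
  have hc : Continuous fun s => γ * Real.exp (-γ * s) * g s := by fun_prop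
  have := (intervalIntegral.integral_hasDerivAt_right
    (intervalIntegrable_exp_mul hγ hg.measurable hg01 0 t)
    (hc.stronglyMeasurableAtFilter volume (𝓝 t)) hc.continuousAt).const_sub
    (∫ s in Ioi (0 : ℝ), γ * Real.exp (-γ * s) * g s)
  exact this.congr_of_eventuallyEq
    (Eventually.of_forall fun t => integral_Ioi_eq_sub hγ hg.measurable hg01 t)

lemma hasDerivAt_exp_const_mul (c t : ℝ) :
    HasDerivAt (fun t => Real.exp (c * t)) (Real.exp (c * t) * c) t := by
  simpa using ((hasDerivAt_id t).const_mul c).exp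

lemma hasDerivAt_tailMean (hγ : 0 < γ) (hg : Continuous g) (hg01 : ∀ s, g s ∈ Icc 0 1)
    (t : ℝ) : HasDerivAt (tailMean γ g) (γ * (tailMean γ g t - g t)) t := by
  refine ((hasDerivAt_exp_const_mul γ t).mul
    (hasDerivAt_integral_exp_mul hγ hg hg01 t)).congr_deriv ?_
  have : Real.exp (γ * t) * Real.exp (-γ * t) = 1 := by rw [← Real.exp_add]; simp
  rw [tailMean]
  linear_combination (-γ * g t) * this

lemma hasDerivAt_exp_mul_sub (hγ : 0 < γ) (hg : Continuous g) (hg01 : ∀ s, g s ∈ Icc 0 1)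
    (hX : ∀ t, HasDerivAt X (X' t) t) (t : ℝ) :
    HasDerivAt (fun t => Real.exp (-γ * t) * X t - ∫ s in Ioi t, γ * Real.exp (-γ * s) * g s)
      (Real.exp (-γ * t) * (X' t - γ * (X t - g t))) t := by
  refine (((hasDerivAt_exp_const_mul (-γ) t).mul (hX t)).sub
    (hasDerivAt_integral_exp_mul hγ hg hg01 t)).congr_deriv ?_
  ring

lemma tendsto_exp_mul_sub (hγ : 0 < γ) (hg : Continuous g) (hg01 : ∀ s, g s ∈ Icc 0 1)
    (hX01 : ∀ t, X t ∈ Icc 0 1) :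
    Tendsto (fun t => Real.exp (-γ * t) * X t - ∫ s in Ioi t, γ * Real.exp (-γ * s) * g s)
      atTop (𝓝 0) := by
  have hexp : Tendsto (fun t => Real.exp (-γ * t)) atTop (𝓝 0) :=
    Real.tendsto_exp_atBot.comp (tendsto_id.const_mul_atTop_of_neg (neg_lt_zero.2 hγ))
  have h1 : Tendsto (fun t => Real.exp (-γ * t) * X t) atTop (𝓝 0) :=
    squeeze_zero (fun t => mul_nonneg (Real.exp_pos _).le (hX01 t).1)
      (fun t => mul_le_of_le_one_right (Real.exp_pos _).le (hX01 t).2) hexp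
  have h2 := squeeze_zero (fun t => (integral_exp_mul_mem hγ hg.measurable hg01 t).1)
    (fun t => (integral_exp_mul_mem hγ hg.measurable hg01 t).2) hexp
  simpa using h1.sub h2

lemma exp_mul_le_iff (t a b : ℝ) : Real.exp (γ * t) * a ≤ b ↔ a ≤ Real.exp (-γ * t) * b := by
  rw [neg_mul, Real.exp_neg, ← div_eq_inv_mul, le_div_iff₀ (Real.exp_pos _), mul_comm]

lemma le_exp_mul_iff (t a b : ℝ) : b ≤ Real.exp (γ * t) * a ↔ Real.exp (-γ * t) * b ≤ a := by
  rw [neg_mul, Real.exp_neg, ← div_eq_inv_mul, div_le_iff₀ (Real.exp_pos _), mul_comm]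

/-- With the integrating factor `e^(-γ t)`, the difference between `X` and the bounded solution is
monotone. It vanishes at `+∞`, which fixes its sign. -/
lemma tailMean_le_of_deriv_le (hγ : 0 < γ) (hg : Continuous g) (hg01 : ∀ s, g s ∈ Icc 0 1)
    (hX01 : ∀ t, X t ∈ Icc 0 1) (hX : ∀ t, HasDerivAt X (X' t) t)
    (hle : ∀ t, X' t ≤ γ * (X t - g t)) (t : ℝ) : tailMean γ g t ≤ X t := by
  have hd := hasDerivAt_exp_mul_sub hγ hg hg01 hX
  have hanti := antitone_of_deriv_nonpos (fun t => (hd t).differentiableAt) fun t => by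
    rw [(hd t).deriv]
    exact mul_nonpos_of_nonneg_of_nonpos (Real.exp_pos _).le (by linarith [hle t])
  have := hanti.le_of_tendsto (tendsto_exp_mul_sub hγ hg hg01 hX01) t
  rw [tailMean, exp_mul_le_iff]
  linarith

lemma le_tailMean_of_le_deriv (hγ : 0 < γ) (hg : Continuous g) (hg01 : ∀ s, g s ∈ Icc 0 1)
    (hX01 : ∀ t, X t ∈ Icc 0 1) (hX : ∀ t, HasDerivAt X (X' t) t)
    (hle : ∀ t, γ * (X t - g t) ≤ X' t) (t : ℝ) : X t ≤ tailMean γ g t := by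
  have hd := hasDerivAt_exp_mul_sub hγ hg hg01 hX
  have hmono := monotone_of_deriv_nonneg (fun t => (hd t).differentiableAt) fun t => by
    rw [(hd t).deriv]
    exact mul_nonneg (Real.exp_pos _).le (by linarith [hle t])
  have := hmono.ge_of_tendsto (tendsto_exp_mul_sub hγ hg hg01 hX01) t
  rw [tailMean, le_exp_mul_iff]
  linarith

lemma tendsto_tailMean (hγ : 0 < γ) {G : ℕ → ℝ → ℝ} (hG : ∀ k, Measurable (G k))
    (hG01 : ∀ k s, G k s ∈ Icc 0 1) (hlim : ∀ s, Tendsto (fun k => G k s) atTop (𝓝 (g s)))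
    (t : ℝ) : Tendsto (fun k => tailMean γ (G k) t) atTop (𝓝 (tailMean γ g t)) := by
  refine Tendsto.const_mul _ (tendsto_integral_of_dominated_convergence
    (fun s => γ * Real.exp (-γ * s)) (fun k => ?_)
    ((integrableOn_exp_mul_Ioi (neg_lt_zero.2 hγ) t).const_mul γ) (fun k => ?_) ?_)
  · exact (integrableOn_exp_mul hγ (hG k) (hG01 k) t).aestronglyMeasurable
  · refine Eventually.of_forall fun s => ?_
    have h1 : 0 < γ * Real.exp (-γ * s) := mul_pos hγ (Real.exp_pos _)
    rw [Real.norm_eq_abs, abs_of_nonneg (mul_nonneg h1.le (hG01 k s).1)]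
    exact mul_le_of_le_one_right h1.le (hG01 k s).2
  · exact Eventually.of_forall fun s => (hlim s).const_mul _

end

/-- Monotone iteration between an ordered pair of sub- and supersolutions. -/
theorem exists_orbit_between {γ δ m q : ℝ} {x₁ x₂ y₁ y₂ : ℝ → ℝ} (hγ : 0 < γ) (hδ : 0 < δ)
    (hm : 0 < m) (hq : 0 < q) (hx₂c : Continuous x₂) (hy₂c : Continuous y₂)
    (hx₁c : Continuous x₁) (hy₁c : Continuous y₁)
    (hx₁ : ∀ t, 0 < x₁ t) (hy₁ : ∀ t, 0 < y₁ t) (hx₂ : ∀ t, x₂ t ≤ 1) (hy₂ : ∀ t, y₂ t ≤ 1)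
    (hx : ∀ t, x₁ t ≤ x₂ t) (hy : ∀ t, y₁ t ≤ y₂ t)
    (hsupx : ∀ t, tailMean γ (fun s => y₂ s ^ m) t ≤ x₂ t)
    (hsupy : ∀ t, tailMean δ (fun s => x₂ s ^ q) t ≤ y₂ t)
    (hsubx : ∀ t, x₁ t ≤ tailMean γ (fun s => y₁ s ^ m) t)
    (hsuby : ∀ t, y₁ t ≤ tailMean δ (fun s => x₁ s ^ q) t) :
    ∃ x y, IsOrbit γ δ m q x y ∧ ∀ t, x t ≤ x₂ t := by
  have hpow : ∀ {z : ℝ → ℝ} {a : ℝ}, 0 < a → Continuous z → Continuous fun s => z s ^ a :=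
    fun ha hz => hz.rpow_const fun _ => Or.inr ha.le
  have hpow01 : ∀ {z : ℝ} {a : ℝ}, 0 < a → 0 < z → z ≤ 1 → z ^ a ∈ Icc (0 : ℝ) 1 :=
    fun ha h0 h1 => ⟨(Real.rpow_pos_of_pos h0 _).le, Real.rpow_le_one h0.le h1 ha.le⟩
  let step : (ℝ → ℝ) × (ℝ → ℝ) → (ℝ → ℝ) × (ℝ → ℝ) := fun z =>
    (tailMean γ fun s => z.2 s ^ m, tailMean δ fun s => z.1 s ^ q)
  -- The iteration starts at the supersolution and decreases. The subsolution below keeps the limit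
  -- positive.
  let Z : ℕ → (ℝ → ℝ) × (ℝ → ℝ) := fun k => step^[k] (x₂, y₂)
  have hZ0 : Z 0 = (x₂, y₂) := rfl
  have hZs : ∀ k, Z (k + 1) = step (Z k) := fun k => Function.iterate_succ_apply' step k _
  have hinv : ∀ k, Continuous (Z k).1 ∧ Continuous (Z k).2 ∧
      (∀ t, x₁ t ≤ (Z k).1 t ∧ (Z k).1 t ≤ x₂ t ∧ (Z (k + 1)).1 t ≤ (Z k).1 t) ∧
      ∀ t, y₁ t ≤ (Z k).2 t ∧ (Z k).2 t ≤ y₂ t ∧ (Z (k + 1)).2 t ≤ (Z k).2 t := by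
    intro k
    induction k with
    | zero =>
      rw [hZs, hZ0]
      exact ⟨hx₂c, hy₂c, fun t => ⟨hx t, le_rfl, hsupx t⟩, fun t => ⟨hy t, le_rfl, hsupy t⟩⟩
    | succ k ih =>
      obtain ⟨hc1, hc2, h1, h2⟩ := ih
      have hp1 : ∀ t, 0 < (Z k).1 t := fun t => (hx₁ t).trans_le (h1 t).1
      have hp2 : ∀ t, 0 < (Z k).2 t := fun t => (hy₁ t).trans_le (h2 t).1
      have hu1 : ∀ t, (Z k).1 t ≤ 1 := fun t => (h1 t).2.1.trans (hx₂ t)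
      have hu2 : ∀ t, (Z k).2 t ≤ 1 := fun t => (h2 t).2.1.trans (hy₂ t)
      have hm1 : ∀ s, (Z k).1 s ^ q ∈ Icc (0 : ℝ) 1 := fun s => hpow01 hq (hp1 s) (hu1 s)
      have hm2 : ∀ s, (Z k).2 s ^ m ∈ Icc (0 : ℝ) 1 := fun s => hpow01 hm (hp2 s) (hu2 s)
      have hl1 : ∀ t, x₁ t ≤ (Z (k + 1)).1 t := fun t => by
        rw [hZs]
        exact (hsubx t).trans (tailMean_mono hγ (hpow hm hy₁c).measurable
          (fun s => hpow01 hm (hy₁ s) ((hy s).trans (hy₂ s))) (hpow hm hc2).measurable hm2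
          (fun s => Real.rpow_le_rpow (hy₁ s).le (h2 s).1 hm.le) t)
      have hl2 : ∀ t, y₁ t ≤ (Z (k + 1)).2 t := fun t => by
        rw [hZs]
        exact (hsuby t).trans (tailMean_mono hδ (hpow hq hx₁c).measurable
          (fun s => hpow01 hq (hx₁ s) ((hx s).trans (hx₂ s))) (hpow hq hc1).measurable hm1
          (fun s => Real.rpow_le_rpow (hx₁ s).le (h1 s).1 hq.le) t)
      have hc1' : Continuous (Z (k + 1)).1 := by
        rw [hZs]; exact continuous_tailMean hγ (hpow hm hc2).measurable hm2
      have hc2' : Continuous (Z (k + 1)).2 := by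
        rw [hZs]; exact continuous_tailMean hδ (hpow hq hc1).measurable hm1
      refine ⟨hc1', hc2', fun t => ⟨hl1 t, (h1 t).2.2.trans (h1 t).2.1, ?_⟩,
        fun t => ⟨hl2 t, (h2 t).2.2.trans (h2 t).2.1, ?_⟩⟩
      · rw [hZs (k + 1)]
        have := tailMean_mono hγ (hpow hm hc2').measurable
          (fun s => hpow01 hm ((hy₁ s).trans_le (hl2 s)) ((h2 s).2.2.trans (hu2 s)))
          (hpow hm hc2).measurable hm2
          (fun s => Real.rpow_le_rpow ((hy₁ s).trans_le (hl2 s)).le (h2 s).2.2 hm.le) t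
        exact this.trans_eq (by rw [hZs k])
      · rw [hZs (k + 1)]
        have := tailMean_mono hδ (hpow hq hc1').measurable
          (fun s => hpow01 hq ((hx₁ s).trans_le (hl1 s)) ((h1 s).2.2.trans (hu1 s)))
          (hpow hq hc1).measurable hm1
          (fun s => Real.rpow_le_rpow ((hx₁ s).trans_le (hl1 s)).le (h1 s).2.2 hq.le) t
        exact this.trans_eq (by rw [hZs k])
  have hlimx : ∀ t, ∃ l, Tendsto (fun k => (Z k).1 t) atTop (𝓝 l) := fun t =>
    ⟨_, tendsto_atTop_ciInf (antitone_nat_of_succ_le fun k => ((hinv k).2.2.1 t).2.2)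
      ⟨x₁ t, by rintro _ ⟨k, rfl⟩; exact ((hinv k).2.2.1 t).1⟩⟩
  have hlimy : ∀ t, ∃ l, Tendsto (fun k => (Z k).2 t) atTop (𝓝 l) := fun t =>
    ⟨_, tendsto_atTop_ciInf (antitone_nat_of_succ_le fun k => ((hinv k).2.2.2 t).2.2)
      ⟨y₁ t, by rintro _ ⟨k, rfl⟩; exact ((hinv k).2.2.2 t).1⟩⟩
  choose x hxlim using hlimx
  choose y hylim using hlimy
  have hx1 : ∀ t, x₁ t ≤ x t := fun t => ge_of_tendsto' (hxlim t) fun k => ((hinv k).2.2.1 t).1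
  have hx2 : ∀ t, x t ≤ x₂ t := fun t => le_of_tendsto' (hxlim t) fun k => ((hinv k).2.2.1 t).2.1
  have hy1 : ∀ t, y₁ t ≤ y t := fun t => ge_of_tendsto' (hylim t) fun k => ((hinv k).2.2.2 t).1
  have hy2 : ∀ t, y t ≤ y₂ t := fun t => le_of_tendsto' (hylim t) fun k => ((hinv k).2.2.2 t).2.1
  have hxpos : ∀ t, 0 < x t := fun t => (hx₁ t).trans_le (hx1 t)
  have hypos : ∀ t, 0 < y t := fun t => (hy₁ t).trans_le (hy1 t)
  have hxm : Measurable x := measurable_of_tendsto_metrizable (fun k => (hinv k).1.measurable)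
    (tendsto_pi_nhds.2 hxlim)
  have hym : Measurable y := measurable_of_tendsto_metrizable (fun k => (hinv k).2.1.measurable)
    (tendsto_pi_nhds.2 hylim)
  have hxq : ∀ s, x s ^ q ∈ Icc (0 : ℝ) 1 := fun s => hpow01 hq (hxpos s) ((hx2 s).trans (hx₂ s))
  have hyq : ∀ s, y s ^ m ∈ Icc (0 : ℝ) 1 := fun s => hpow01 hm (hypos s) ((hy2 s).trans (hy₂ s))
  -- The pointwise limits are at first only measurable. Dominated convergence gives the fixed point
  -- equations, which yield continuity and then differentiability.
  have hxeq : x = tailMean γ fun s => y s ^ m := by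
    ext t
    refine tendsto_nhds_unique ((hxlim t).comp (tendsto_add_atTop_nat 1)) ?_
    refine (tendsto_tailMean hγ (G := fun k s => (Z k).2 s ^ m)
      (fun k => (hpow hm (hinv k).2.1).measurable) (fun k s => ?_)
      (fun s => (hylim s).rpow_const (Or.inr hm.le)) t).congr fun k => ?_
    · have := (hinv k).2.2.2 s
      exact hpow01 hm ((hy₁ s).trans_le this.1) (this.2.1.trans (hy₂ s))
    · simp only [Function.comp_apply]; rw [hZs]
  have hyeq : y = tailMean δ fun s => x s ^ q := by
    ext t
    refine tendsto_nhds_unique ((hylim t).comp (tendsto_add_atTop_nat 1)) ?_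
    refine (tendsto_tailMean hδ (G := fun k s => (Z k).1 s ^ q)
      (fun k => (hpow hq (hinv k).1).measurable) (fun k s => ?_)
      (fun s => (hxlim s).rpow_const (Or.inr hq.le)) t).congr fun k => ?_
    · have := (hinv k).2.2.1 s
      exact hpow01 hq ((hx₁ s).trans_le this.1) (this.2.1.trans (hx₂ s))
    · simp only [Function.comp_apply]; rw [hZs]
  have hxc : Continuous x := by
    rw [hxeq]; exact continuous_tailMean hγ (hym.pow_const m) hyq
  have hyc : Continuous y := by
    rw [hyeq]; exact continuous_tailMean hδ (hxm.pow_const q) hxq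
  refine ⟨x, y, fun t => ⟨hxpos t, hypos t, ?_, ?_⟩, hx2⟩
  · have := hasDerivAt_tailMean hγ (hpow hm hyc) hyq t
    rwa [← hxeq] at this
  · have := hasDerivAt_tailMean hδ (hpow hq hxc) hxq t
    rwa [← hyeq] at this

/-! ### Explicit sub- and supersolutions and a nonconstant orbit. -/

/-- The profile `(1 + k e^(-μ t))^(-a)`. -/
noncomputable def profile (μ k a t : ℝ) : ℝ := (1 + k * Real.exp (-μ * t)) ^ (-a)

section
variable {μ k a : ℝ}

lemma profile_base_pos (hk : 0 < k) (t : ℝ) : 1 < 1 + k * Real.exp (-μ * t) := by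
  have := mul_pos hk (Real.exp_pos (-μ * t)); linarith

lemma profile_pos (hk : 0 < k) (t : ℝ) : 0 < profile μ k a t :=
  Real.rpow_pos_of_pos (zero_lt_one.trans (profile_base_pos hk t)) _

lemma profile_lt_one (hk : 0 < k) (ha : 0 < a) (t : ℝ) : profile μ k a t < 1 :=
  Real.rpow_lt_one_of_one_lt_of_neg (profile_base_pos hk t) (neg_lt_zero.2 ha)

lemma hasDerivAt_profile (hk : 0 < k) (t : ℝ) : HasDerivAt (profile μ k a)
    (a * μ * profile μ k a t * (1 - (1 + k * Real.exp (-μ * t))⁻¹)) t := by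
  have hb := (zero_lt_one.trans (profile_base_pos (μ := μ) hk t)).ne'
  refine ((((hasDerivAt_exp_const_mul (-μ) t).const_mul k).const_add 1).rpow_const
    (p := -a) (Or.inl hb)).congr_deriv ?_
  rw [Real.rpow_sub_one hb, profile]
  field_simp
  ring

lemma continuous_profile (hk : 0 < k) : Continuous (profile μ k a) :=
  continuous_iff_continuousAt.2 fun t => (hasDerivAt_profile hk t).continuousAt

lemma profile_rpow (hk : 0 < k) (b t : ℝ) : profile μ k a t ^ b = profile μ k (a * b) t := by
  rw [profile, profile, ← Real.rpow_mul (zero_lt_one.trans (profile_base_pos hk t)).le, neg_mul a b]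

lemma profile_add (hk : 0 < k) (b t : ℝ) :
    profile μ k (a + b) t = profile μ k a t * (1 + k * Real.exp (-μ * t))⁻¹ ^ b := by
  have := zero_lt_one.trans (profile_base_pos (μ := μ) hk t)
  rw [profile, profile, Real.inv_rpow this.le, ← Real.rpow_neg this.le, ← Real.rpow_add this]
  ring_nf

/-- Bernoulli's inequality `(1 + s u)^(1/s) ≥ 1 + u`. It orders the subsolution below the
supersolution. -/
lemma profile_le_profile_one {s : ℝ} (hs : 0 < s) (hs1 : s ≤ 1) (ha : 0 < a) (t : ℝ) :
    profile μ s (a / s) t ≤ profile μ 1 a t := by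
  have h1 := one_add_mul_self_le_rpow_one_add (s := s * Real.exp (-μ * t))
    (by have := mul_pos hs (Real.exp_pos (-μ * t)); linarith) (p := 1 / s)
    ((one_le_div hs).2 hs1)
  have h2 : 1 / s * (s * Real.exp (-μ * t)) = 1 * Real.exp (-μ * t) := by field_simp
  rw [h2] at h1
  have h3 : profile μ s (a / s) t = ((1 + s * Real.exp (-μ * t)) ^ (1 / s)) ^ (-a) := by
    rw [profile, ← Real.rpow_mul (zero_lt_one.trans (profile_base_pos hs t)).le]
    ring_nf
  rw [h3, profile]
  exact Real.rpow_le_rpow_of_nonpos (zero_lt_one.trans (profile_base_pos one_pos t)) h1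
    (neg_nonpos.2 ha.le)
end

/-- A nonconstant orbit, when the ratio of the exponents is ordered. -/
lemma exists_orbit_of_ordered {γ δ m q μ n : ℝ} (hγ : 0 < γ) (hδ : 0 < δ) (hm : 0 < m) (hq : 0 < q)
    (hμ : 0 < μ) (hn : 0 < n) (hmn : m * n = 1 + μ / γ) (hqn : q = n * (1 + μ / δ))
    (hs : n * γ ≤ δ) : ∃ x y, IsOrbit γ δ m q x y ∧ ∀ t, x t < 1 := by
  set s := n * γ / δ with hsdef
  have hs0 : 0 < s := by positivity
  have hs1 : s ≤ 1 := (div_le_one hδ).2 hs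
  have hγμ : 0 < γ / μ := by positivity
  have hnγμ : 0 < n * γ / μ := by positivity
  have hδs : δ * s = n * γ := by rw [hsdef]; field_simp
  have hbern : ∀ t, (1 + 1 * Real.exp (-μ * t))⁻¹ ^ s ≤
      1 - s * (1 - (1 + 1 * Real.exp (-μ * t))⁻¹) := by
    intro t
    have h1 := zero_lt_one.trans (profile_base_pos (μ := μ) one_pos t)
    have h2 := inv_pos.2 h1
    have := rpow_one_add_le_one_add_mul_self (s := (1 + 1 * Real.exp (-μ * t))⁻¹ - 1)
      (by linarith) hs0.le hs1
    rw [add_sub_cancel] at this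
    linarith
  have hbern' : ∀ t, 1 - 1 / s * (1 - (1 + s * Real.exp (-μ * t))⁻¹) ≤
      (1 + s * Real.exp (-μ * t))⁻¹ ^ (1 / s) := by
    intro t
    have h1 := zero_lt_one.trans (profile_base_pos (μ := μ) hs0 t)
    have h2 := inv_pos.2 h1
    have := one_add_mul_self_le_rpow_one_add (s := (1 + s * Real.exp (-μ * t))⁻¹ - 1)
      (by linarith) (p := 1 / s) ((one_le_div hs0).2 hs1)
    rw [add_sub_cancel] at this
    linarith
  have hpc : ∀ {k a b : ℝ}, 0 < k → 0 < a → 0 < b → Continuous (fun t => profile μ k a t ^ b) :=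
    fun hk _ hb => (continuous_profile hk).rpow_const fun _ => Or.inr hb.le
  have hp01 : ∀ {k a : ℝ}, 0 < k → 0 < a → ∀ t, profile μ k a t ∈ Icc (0 : ℝ) 1 :=
    fun hk ha t => ⟨(profile_pos hk t).le, (profile_lt_one hk ha t).le⟩
  have hpp01 : ∀ {k a b : ℝ}, 0 < k → 0 < a → 0 < b → ∀ t, profile μ k a t ^ b ∈ Icc (0 : ℝ) 1 :=
    fun hk ha hb t => by rw [profile_rpow hk]; exact hp01 hk (mul_pos ha hb) t
  suffices ∃ x y, IsOrbit γ δ m q x y ∧ ∀ t, x t ≤ profile μ 1 (γ / μ) t by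
    obtain ⟨x, y, hxy, hle⟩ := this
    exact ⟨x, y, hxy, fun t => (hle t).trans_lt (profile_lt_one one_pos hγμ t)⟩
  -- Write `B` for the base of a profile. The upper pair solves the first equation exactly, and its
  -- second inequality is `B^(-s) ≤ 1 - s (1 - B⁻¹)`. The lower pair, with `s` in the base and
  -- exponents divided by `s`, solves the second equation exactly, and its first inequality is the
  -- reverse Bernoulli bound with exponent `1/s`.
  refine exists_orbit_between (x₁ := profile μ s (γ / μ / s))
    (x₂ := profile μ 1 (γ / μ)) (y₁ := profile μ s (n * γ / μ / s))
    (y₂ := profile μ 1 (n * γ / μ)) hγ hδ hm hq (continuous_profile one_pos)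
    (continuous_profile one_pos) (continuous_profile hs0) (continuous_profile hs0)
    (profile_pos hs0) (profile_pos hs0) (fun t => (profile_lt_one one_pos hγμ t).le)
    (fun t => (profile_lt_one one_pos hnγμ t).le) (profile_le_profile_one hs0 hs1 hγμ)
    (profile_le_profile_one hs0 hs1 hnγμ)
    (tailMean_le_of_deriv_le hγ (hpc one_pos hnγμ hm) (hpp01 one_pos hnγμ hm) (hp01 one_pos hγμ)
      (hasDerivAt_profile one_pos) fun t => ?_)
    (tailMean_le_of_deriv_le hδ (hpc one_pos hγμ hq) (hpp01 one_pos hγμ hq) (hp01 one_pos hnγμ)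
      (hasDerivAt_profile one_pos) fun t => ?_)
    (le_tailMean_of_le_deriv hγ (hpc hs0 (by positivity) hm) (hpp01 hs0 (by positivity) hm)
      (hp01 hs0 (by positivity)) (hasDerivAt_profile hs0) fun t => ?_)
    (le_tailMean_of_le_deriv hδ (hpc hs0 (by positivity) hq) (hpp01 hs0 (by positivity) hq)
      (hp01 hs0 (by positivity)) (hasDerivAt_profile hs0) fun t => ?_)
  · rw [profile_rpow one_pos, show n * γ / μ * m = γ / μ + 1 by
      rw [show n * γ / μ * m = γ / μ * (m * n) by ring, hmn]; field_simp, profile_add one_pos,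
      Real.rpow_one, show γ / μ * μ = γ by field_simp]
    exact le_of_eq (by ring)
  · rw [profile_rpow one_pos, show γ / μ * q = n * γ / μ + s by
      rw [hqn, hsdef]; field_simp, profile_add one_pos, show n * γ / μ * μ = δ * s by
      rw [hδs]; field_simp]
    have h1 := mul_le_mul_of_nonneg_left (hbern t) (mul_pos hδ
      (profile_pos (μ := μ) (a := n * γ / μ) one_pos t)).le
    linarith
  · rw [profile_rpow hs0, show n * γ / μ / s * m = γ / μ / s + 1 / s by
      rw [show n * γ / μ / s * m = γ / μ / s * (m * n) by ring, hmn]; field_simp, profile_add hs0,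
      show γ / μ / s * μ = γ * (1 / s) by field_simp]
    have h1 := mul_le_mul_of_nonneg_left (hbern' t) (mul_pos hγ
      (profile_pos (μ := μ) (a := γ / μ / s) hs0 t)).le
    linarith
  · rw [profile_rpow hs0, show γ / μ / s * q = n * γ / μ / s + 1 by
      rw [hqn, hsdef]; field_simp, profile_add hs0, Real.rpow_one,
      show n * γ / μ / s * μ = δ by rw [hsdef]; field_simp]
    exact le_of_eq (by ring)

/-- There is an orbit different from the equilibrium. -/
theorem exists_orbit_ne_one {γ δ m q : ℝ} (hγ : 0 < γ) (hδ : 0 < δ) (hm : 0 < m) (hq : 0 < q)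
    (hmq : 1 < m * q) : ∃ x y, IsOrbit γ δ m q x y ∧ x 0 ≠ 1 := by
  -- `-μ` is the negative eigenvalue of the linearization at `(1,1)`, and `n` below is the slope of
  -- its eigenvector.
  obtain ⟨μ, hμ, hμeq⟩ : ∃ μ, 0 < μ ∧ (1 + μ / γ) * (1 + μ / δ) = m * q := by
    have hc : ContinuousOn (fun μ : ℝ => (1 + μ / γ) * (1 + μ / δ)) (Icc 0 (γ * (m * q))) := by
      fun_prop
    have hmem : m * q ∈ Icc ((fun μ : ℝ => (1 + μ / γ) * (1 + μ / δ)) 0)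
        ((fun μ : ℝ => (1 + μ / γ) * (1 + μ / δ)) (γ * (m * q))) := by
      refine ⟨by simp [hmq.le], ?_⟩
      have h1 : γ * (m * q) / γ = m * q := by field_simp
      have h2 : 0 < γ * (m * q) / δ := by positivity
      simp only [h1]
      nlinarith
    obtain ⟨μ, hμ, hμeq⟩ := intermediate_value_Icc (by positivity) hc hmem
    refine ⟨μ, lt_of_le_of_ne hμ.1 ?_, hμeq⟩
    rintro rfl
    simp at hμeq
    linarith
  set n := (1 + μ / γ) / m with hn
  have hn0 : 0 < n := by positivity
  have hmn : m * n = 1 + μ / γ := by rw [hn]; field_simp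
  have hqn : q = n * (1 + μ / δ) := by
    have : m * q = m * (n * (1 + μ / δ)) := by rw [← hμeq, ← mul_assoc, hmn]
    exact mul_left_cancel₀ hm.ne' this
  rcases le_total (n * γ) δ with hs | hs
  · obtain ⟨x, y, hxy, hlt⟩ := exists_orbit_of_ordered hγ hδ hm hq hμ hn0 hmn hqn hs
    exact ⟨x, y, hxy, (hlt 0).ne⟩
  -- Exchanging the components replaces `n` by `n⁻¹` and reverses the order condition. The strict
  -- bound then concerns the other component, and the dichotomy transfers it.
  · obtain ⟨x, y, hxy, hlt⟩ := exists_orbit_of_ordered (n := n⁻¹) hδ hγ hq hm hμ (inv_pos.2 hn0)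
      (by rw [hqn]; field_simp) (by rw [← hmn]; field_simp)
      (by rw [inv_mul_le_iff₀ hn0]; exact hs)
    refine ⟨y, x, hxy.swap, fun h0 => (hlt 0).ne ?_⟩
    rcases hxy.dichotomy hδ hγ hq hm (by linarith) with h1 | h1
    · exact (h1 0).1
    · exact absurd h0 (hxy.swap.fst_lt_one hm hmq (fun t => (h1 t).symm) 0).ne

/-! ### Sign and comparison of the fluxes of global solutions for `ε = -1`. -/

/-- The flux of a global solution is negative when `ε = -1`. -/
theorem IsFluxSystem.flux_neg {θ τ m q : ℝ} {w F : ℝ → ℝ} (hθ : 0 < θ) (hτ : 0 < τ)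
    (hm : 0 < m) (hq : 0 < q) (hmq : 1 < m * q) (h : IsFluxSystem θ τ m q (-1) (Ioi 0) w F)
    {r₀ : ℝ} (hr₀ : 0 < r₀) : F r₀ < 0 := by
  by_contra! hF₀
  have hFmono : StrictMonoOn F (Ici r₀) := by
    refine strictMonoOn_of_deriv_pos (convex_Ici r₀)
      (fun r hr => (h r (hr₀.trans_le hr)).2.2.continuousAt.continuousWithinAt) fun r hr => ?_
    have hr0 : 0 < r := hr₀.trans_le (interior_subset hr)
    rw [(h r hr0).2.2.deriv]
    have := mul_pos (Real.rpow_pos_of_pos hr0 (τ - 1)) (Real.rpow_pos_of_pos (h r hr0).1 q)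
    linarith
  have hFpos : ∀ r, r₀ + 1 ≤ r → 0 < F r := fun r hr =>
    hF₀.trans_lt (hFmono self_mem_Ici (show r₀ ≤ r by linarith) (by linarith))
  set e := (m * q - 1) / (q + m + 2) with he
  have he0 : 0 < e := div_pos (by linarith) (by positivity)
  have hd : ∀ r, r₀ + 1 ≤ r → HasDerivAt (fun r => (w r * F r) ^ (-e))
      (-(e * (w r * F r) ^ (-e) * (r ^ (θ - 1) * (F r ^ m / w r)
        + r ^ (τ - 1) * (w r ^ q / F r)))) r := by
    intro r hr
    have hr0 : 0 < r := by linarith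
    obtain ⟨hw, hdw, hdF⟩ := h r hr0
    have hF := hFpos r hr
    refine ((hdw.mul hdF).rpow_const (Or.inl (mul_pos hw hF).ne')).congr_deriv ?_
    simp only [Pi.mul_apply]
    rw [Real.rpow_sub_one (mul_pos hw hF).ne', spow_of_pos hF]
    field_simp
  -- Beyond `r₀ + 1` the flux is strictly positive, and `r ≥ 1` lets both weights be bounded below
  -- by `r^(min θ τ - 1)`. The AM-GM bound then makes `(w F)^(-e)` negative at a finite radius.
  obtain ⟨r, hr, hneg⟩ := exists_neg_of_deriv_le (a := r₀ + 1) (α := min θ τ) (by linarith)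
    he0 (lt_min hθ hτ) hd fun r hr => by
      have hr0 : 0 < r := by linarith
      have hw := (h r hr0).1
      have hF := hFpos r hr
      have hwF := mul_pos hw hF
      have h1 := rpow_mul_sub_one_le hm hq hw hF
      rw [← he] at h1
      have ha : (q + 1) / (q + m + 2) ≤ 1 := by rw [div_le_one (by positivity)]; linarith
      have hb : (m + 1) / (q + m + 2) ≤ 1 := by rw [div_le_one (by positivity)]; linarith
      have hR : 0 < F r ^ m / w r := by positivity
      have hk : 0 < w r ^ q / F r := by positivity
      have hf : 0 < (w r * F r) ^ e := by positivity
      have h2 : r ^ (min θ τ - 1) ≤ r ^ (θ - 1) :=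
        Real.rpow_le_rpow_of_exponent_le (by linarith) (by linarith [min_le_left θ τ])
      have h3 : r ^ (min θ τ - 1) ≤ r ^ (τ - 1) :=
        Real.rpow_le_rpow_of_exponent_le (by linarith) (by linarith [min_le_right θ τ])
      have h0 : 0 < r ^ (min θ τ - 1) := Real.rpow_pos_of_pos hr0 _
      rw [Real.rpow_neg hwF.le]
      set f := (w r * F r) ^ e
      set R := F r ^ m / w r
      set k := w r ^ q / F r
      have h4 : f ≤ R + k := by nlinarith
      have h5 : r ^ (min θ τ - 1) * f ≤ r ^ (θ - 1) * R + r ^ (τ - 1) * k := by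
        calc r ^ (min θ τ - 1) * f ≤ r ^ (min θ τ - 1) * (R + k) := by gcongr
          _ = r ^ (min θ τ - 1) * R + r ^ (min θ τ - 1) * k := by ring
          _ ≤ _ := by gcongr
      have h6 := mul_le_mul_of_nonneg_left h5 (show 0 ≤ e * f⁻¹ by positivity)
      have h7 : e * f⁻¹ * (r ^ (min θ τ - 1) * f) = e * r ^ (min θ τ - 1) := by field_simp
      linarith
  exact absurd (Real.rpow_pos_of_pos (mul_pos (h r (show (0 : ℝ) < r by linarith)).1 (hFpos r hr)) (-e))
    (by linarith)

/-- Global solutions with the same value at the origin have ordered fluxes there. -/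
lemma IsFluxSystem.flux_limit_le {θ τ m q w₀ a b : ℝ} {w₁ F₁ w₂ F₂ : ℝ → ℝ} (hθ : 0 < θ)
    (hτ : 0 < τ) (hm : 0 < m) (hq : 0 < q) (hmq : 1 < m * q)
    (h₁ : IsFluxSystem θ τ m q (-1) (Ioi 0) w₁ F₁) (h₂ : IsFluxSystem θ τ m q (-1) (Ioi 0) w₂ F₂)
    (hw₁ : Tendsto w₁ (𝓝[>] 0) (𝓝 w₀)) (hw₂ : Tendsto w₂ (𝓝[>] 0) (𝓝 w₀))
    (hF₁ : Tendsto F₁ (𝓝[>] 0) (𝓝 a)) (hF₂ : Tendsto F₂ (𝓝[>] 0) (𝓝 b)) : b ≤ a := by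
  by_contra! hab
  obtain ⟨s, hs, hsF⟩ := mem_nhdsGT_iff_exists_Ioo_subset.1 (hF₁.eventually_lt hF₂ hab)
  have hs0 : 0 < s := hs
  have hlt : ∀ r, 0 < r → r < s → F₁ r < F₂ r := fun r hr hrs => hsF ⟨hr, hrs⟩
  have hdD : ∀ r, 0 < r → HasDerivAt (fun r => w₂ r - w₁ r)
      (r ^ (θ - 1) * spow m (F₂ r) - r ^ (θ - 1) * spow m (F₁ r)) r := fun r hr =>
    (h₂ r hr).2.1.sub (h₁ r hr).2.1
  have hdE : ∀ r, 0 < r → HasDerivAt (fun r => F₂ r - F₁ r)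
      (- -1 * r ^ (τ - 1) * w₂ r ^ q - - -1 * r ^ (τ - 1) * w₁ r ^ q) r := fun r hr =>
    (h₂ r hr).2.2.sub (h₁ r hr).2.2
  have hneg₁ : ∀ r, 0 < r → F₁ r < 0 := fun r hr => h₁.flux_neg hθ hτ hm hq hmq hr
  have hneg₂ : ∀ r, 0 < r → F₂ r < 0 := fun r hr => h₂.flux_neg hθ hτ hm hq hmq hr
  have hD'pos : ∀ r, 0 < r → F₁ r < F₂ r →
      0 < r ^ (θ - 1) * spow m (F₂ r) - r ^ (θ - 1) * spow m (F₁ r) := by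
    intro r hr hF
    rw [spow_of_neg (hneg₁ r hr), spow_of_neg (hneg₂ r hr)]
    have h1 := Real.rpow_lt_rpow (show 0 ≤ -F₂ r by linarith [hneg₂ r hr])
      (show -F₂ r < -F₁ r by linarith) hm
    have h2 := Real.rpow_pos_of_pos hr (θ - 1)
    nlinarith
  have hD0 : 0 ≤ w₂ (s / 2) - w₁ (s / 2) := by
    have := le_of_tendsto_of_deriv_nonpos (L := 0) (r := s / 2) (by positivity)
      (fun r hr _ => (hdD r hr).neg)
      (fun r hr hrs => by linarith [hD'pos r hr (hlt r hr (by linarith))])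
      (by have := (hw₂.sub hw₁).neg; rwa [sub_self, neg_zero] at this)
    simp only [Pi.neg_apply] at this
    linarith
  -- Equal limits at `0` give only `w₁ ≤ w₂` at `s/2`; the positive derivative makes the inequality
  -- strict just after, as the comparison requires.
  obtain ⟨t, htD, ht1, ht2⟩ := ((eventually_gt_of_hasDerivAt_pos (hdD (s / 2) (by positivity))
    (hD'pos _ (by positivity) (hlt _ (by positivity) (by linarith)))).and
    (Ioo_mem_nhdsGT (show s / 2 < s by linarith))).exists
  have ht0 : 0 < t := by linarith
  have hE : ∀ r, t ≤ r → F₂ t - F₁ t ≤ F₂ r - F₁ r := fun r hr =>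
    (le_of_cooperative (fun u hu => hdD u (ht0.trans_le hu)) (fun u hu => hdE u (ht0.trans_le hu))
      (hD0.trans_lt htD) (sub_pos.2 (hlt t ht0 ht2)) (fun u hu h3 h4 => by
        have hu0 := ht0.trans_le hu
        refine ⟨(hD'pos u hu0 (sub_pos.1 h4)).le, ?_⟩
        have h5 := Real.rpow_le_rpow (h₁ u hu0).1.le (sub_pos.1 h3).le hq.le
        have h6 := Real.rpow_pos_of_pos hu0 (τ - 1)
        nlinarith) hr).2
  -- The gap `F₂ - F₁` never shrinks while `F₂ < 0`, so `F₁` stays below a negative constant and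
  -- `w₁` could not remain positive.
  obtain ⟨r, hr, hFr⟩ := (h₁.mono (Ici_subset_Ioi.2 ht0)).exists_flux_gt
    (c := F₂ t - F₁ t) hθ ht0 (sub_pos.2 (hlt t ht0 ht2)) hm
  linarith [hE r hr, hneg₂ r (ht0.trans_le hr)]

/-! ### Logarithmic time and the classification of global solutions. -/

section
variable {θ τ m q γ δ a b : ℝ} {w F x y : ℝ → ℝ}

/-- Passage from a global solution to logarithmic time. -/
lemma IsFluxSystem.isOrbit (hδm : δ * m = γ + θ) (hγq : γ * q = δ + τ) (ha : 0 < a) (hb : 0 < b)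
    (hγa : γ * a = b ^ m) (hδb : δ * b = a ^ q)
    (h : IsFluxSystem θ τ m q (-1) (Ioi 0) w F) (hF : ∀ r, 0 < r → F r < 0) :
    IsOrbit γ δ m q (fun t => Real.exp (γ * t) * w (Real.exp t) / a)
      (fun t => Real.exp (δ * t) * -F (Real.exp t) / b) := by
  intro t
  have he := Real.exp_pos t
  obtain ⟨hw, hdw, hdF⟩ := h _ he
  have hFt : 0 < -F (Real.exp t) := neg_pos.2 (hF _ he)
  refine ⟨by positivity, by positivity, ?_, ?_⟩
  · refine (((hasDerivAt_exp_const_mul γ t).mul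
      (hdw.scomp t (Real.hasDerivAt_exp t))).div_const a).congr_deriv ?_
    rw [Real.div_rpow (by positivity) hb.le, Real.mul_rpow (Real.exp_pos _).le hFt.le, ← hγa,
      spow_of_neg (hF _ he), ← Real.exp_mul, ← Real.exp_mul]
    have h1 : Real.exp (δ * t * m) = Real.exp (γ * t) * (Real.exp t * Real.exp (t * (θ - 1))) := by
      rw [← Real.exp_add, ← Real.exp_add]
      congr 1
      linear_combination t * hδm
    rw [h1]
    simp only [smul_eq_mul, Function.comp_apply]
    have hγ0 : γ ≠ 0 := by rintro rfl; have := Real.rpow_pos_of_pos hb m; linarith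
    field_simp
    ring
  · refine (((hasDerivAt_exp_const_mul δ t).mul
      (hdF.scomp t (Real.hasDerivAt_exp t)).neg).div_const b).congr_deriv ?_
    rw [Real.div_rpow (by positivity) ha.le, Real.mul_rpow (Real.exp_pos _).le hw.le, ← hδb,
      ← Real.exp_mul, ← Real.exp_mul]
    have h1 : Real.exp (γ * t * q) = Real.exp (δ * t) * (Real.exp t * Real.exp (t * (τ - 1))) := by
      rw [← Real.exp_add, ← Real.exp_add]
      congr 1
      linear_combination t * hγq
    rw [h1]
    simp only [smul_eq_mul, Function.comp_apply, Pi.neg_apply]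
    have hδ0 : δ ≠ 0 := by rintro rfl; have := Real.rpow_pos_of_pos ha q; linarith
    field_simp
    ring

/-- Passage from an orbit to a global solution. -/
lemma IsOrbit.isFluxSystem (hδm : δ * m = γ + θ) (hγq : γ * q = δ + τ) (ha : 0 < a) (hb : 0 < b)
    (hγa : γ * a = b ^ m) (hδb : δ * b = a ^ q) (h : IsOrbit γ δ m q x y) :
    IsFluxSystem θ τ m q (-1) (Ioi 0) (fun r => a * r ^ (-γ) * x (Real.log r))
      (fun r => -(b * r ^ (-δ) * y (Real.log r))) := by
  intro r hr
  have hr : 0 < r := hr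
  obtain ⟨hx, hy, hdx, hdy⟩ := h (Real.log r)
  refine ⟨by positivity, ?_, ?_⟩
  · refine ((((Real.hasDerivAt_rpow_const (p := -γ) (Or.inl hr.ne')).const_mul a).mul
      (hdx.scomp r (Real.hasDerivAt_log hr.ne')))).congr_deriv ?_
    rw [spow_of_neg (by have : 0 < b * r ^ (-δ) * y (Real.log r) := by positivity
                        linarith), neg_neg, Real.mul_rpow (by positivity) hy.le,
      Real.mul_rpow hb.le (by positivity), ← Real.rpow_mul hr.le, ← hγa,
      Real.rpow_sub_one hr.ne' (-γ)]
    have h1 : r ^ (-γ) = r ^ (θ - 1) * r ^ (-δ * m) * r := by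
      rw [← Real.rpow_add hr, ← Real.rpow_add_one hr.ne']
      congr 1
      linear_combination hδm
    rw [h1]
    simp only [smul_eq_mul, Function.comp_apply]
    field_simp
    ring
  · refine ((((Real.hasDerivAt_rpow_const (p := -δ) (Or.inl hr.ne')).const_mul b).mul
      (hdy.scomp r (Real.hasDerivAt_log hr.ne'))).neg).congr_deriv ?_
    rw [Real.mul_rpow (by positivity) hx.le,
      Real.mul_rpow ha.le (by positivity), ← Real.rpow_mul hr.le, ← hδb,
      Real.rpow_sub_one hr.ne' (-δ)]
    have h1 : r ^ (-δ) = r ^ (τ - 1) * r ^ (-γ * q) * r := by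
      rw [← Real.rpow_add hr, ← Real.rpow_add_one hr.ne']
      congr 1
      linear_combination hγq
    rw [h1]
    simp only [smul_eq_mul, Function.comp_apply]
    field_simp
    ring

/-- A global solution is the self-similar one, or has a positive limit and a negative flux at the
origin and is asymptotic to the self-similar one at infinity. -/
theorem IsFluxSystem.global_dichotomy (hθ : 0 < θ) (hτ : 0 < τ) (hm : 0 < m) (hq : 0 < q)
    (hmq : 1 < m * q) (hγ : 0 < γ) (hδ : 0 < δ) (hδm : δ * m = γ + θ) (hγq : γ * q = δ + τ)
    (ha : 0 < a) (hb : 0 < b) (hγa : γ * a = b ^ m) (hδb : δ * b = a ^ q)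
    (h : IsFluxSystem θ τ m q (-1) (Ioi 0) w F) :
    (∀ r, 0 < r → w r = a * r ^ (-γ)) ∨
    ∃ w₀ F₀, 0 < w₀ ∧ F₀ < 0 ∧ Tendsto w (𝓝[>] 0) (𝓝 w₀) ∧ Tendsto F (𝓝[>] 0) (𝓝 F₀) ∧
      Tendsto (fun r => w r / (a * r ^ (-γ))) atTop (𝓝 1) := by
  have hneg : ∀ r, 0 < r → F r < 0 := fun r hr => h.flux_neg hθ hτ hm hq hmq hr
  have horb := h.isOrbit hδm hγq ha hb hγa hδb hneg
  have hexp : ∀ r, 0 < r → Real.exp (γ * Real.log r) = r ^ γ := fun r hr => by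
    rw [Real.rpow_def_of_pos hr, mul_comm]
  rcases horb.dichotomy hγ hδ hm hq hmq with h1 | h1
  · refine Or.inl fun r hr => ?_
    have := (h1 (Real.log r)).1
    rw [hexp r hr, Real.exp_log hr, div_eq_one_iff_eq ha.ne'] at this
    rw [← this, Real.rpow_neg hr.le]
    field_simp
  · right
    obtain ⟨hx0, hy0⟩ := horb.tendsto_atBot hγ hδ hm hq hmq h1
    obtain ⟨u₀, hu₀, hu⟩ := horb.exists_limit_exp_mul hγ hδ hm hq hmq (by linarith)
      (by linarith) hx0 hy0
    have hw : Tendsto w (𝓝[>] 0) (𝓝 (a * u₀)) := by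
      refine ((hu.comp Real.tendsto_log_nhdsGT_zero).const_mul a).congr' ?_
      filter_upwards [self_mem_nhdsWithin] with r hr
      have hr : 0 < r := hr
      simp only [Function.comp_apply]
      rw [neg_mul, Real.exp_neg, hexp r hr, Real.exp_log hr]
      field_simp
    have hsub : Ioo (0 : ℝ) 1 ⊆ Ioi 0 := Ioo_subset_Ioi_self
    obtain ⟨F₀, hF⟩ := (h.mono hsub).exists_flux_limit hτ hq (Or.inr rfl) one_pos hw
    have hF₀ : F₀ ≤ F 1 := by
      have := le_of_tendsto_of_deriv_nonpos one_pos (fun s hs _ => (h s hs).2.2.neg)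
        (fun s hs _ => by
          have := mul_pos (Real.rpow_pos_of_pos hs (τ - 1)) (Real.rpow_pos_of_pos (h s hs).1 q)
          linarith) hF.neg
      simp only [Pi.neg_apply] at this
      linarith
    refine ⟨a * u₀, F₀, by positivity, hF₀.trans_lt (hneg 1 one_pos), hw, hF, ?_⟩
    refine ((horb.tendsto_atTop hγ hδ hm hq hmq h1).comp Real.tendsto_log_atTop).congr' ?_
    filter_upwards [eventually_gt_atTop 0] with r hr
    simp only [Function.comp_apply]
    rw [hexp r hr, Real.exp_log hr, Real.rpow_neg hr.le]
    field_simp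

/-- Existence of global solutions with prescribed value at the origin. -/
theorem exists_global_solution (hθ : 0 < θ) (hτ : 0 < τ) (hm : 0 < m) (hq : 0 < q)
    (hmq : 1 < m * q) (hγ : 0 < γ) (hδ : 0 < δ) (hδm : δ * m = γ + θ) (hγq : γ * q = δ + τ)
    (ha : 0 < a) (hb : 0 < b) (hγa : γ * a = b ^ m) (hδb : δ * b = a ^ q) {w₀ : ℝ}
    (hw₀ : 0 < w₀) :
    ∃ w F F₀, IsFluxSystem θ τ m q (-1) (Ioi 0) w F ∧ F₀ < 0 ∧
      Tendsto w (𝓝[>] 0) (𝓝 w₀) ∧ Tendsto F (𝓝[>] 0) (𝓝 F₀) ∧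
      Tendsto (fun r => w r / (a * r ^ (-γ))) atTop (𝓝 1) := by
  obtain ⟨x, y, hxy, hx1⟩ := exists_orbit_ne_one hγ hδ hm hq hmq
  have hinc := (hxy.dichotomy hγ hδ hm hq hmq).resolve_left fun h => hx1 (h 0).1
  obtain ⟨hx0, hy0⟩ := hxy.tendsto_atBot hγ hδ hm hq hmq hinc
  obtain ⟨u₀, hu₀, hu⟩ := hxy.exists_limit_exp_mul hγ hδ hm hq hmq (by linarith)
    (by linarith) hx0 hy0
  -- A time shift by `s` is a dilation in `r`; it multiplies the limit of `w` at `0` by `e^(γ s)`,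
  -- and `s` is chosen so that `a e^(γ s) u₀ = w₀`.
  set s := Real.log (w₀ / (a * u₀)) / γ with hs
  have hshift : IsOrbit γ δ m q (fun t => x (t + s)) (fun t => y (t + s)) := fun t =>
    ⟨(hxy _).1, (hxy _).2.1, (hxy (t + s)).2.2.1.comp_add_const t s,
      (hxy (t + s)).2.2.2.comp_add_const t s⟩
  have hsys := hshift.isFluxSystem hδm hγq ha hb hγa hδb
  have hw : Tendsto (fun r => a * r ^ (-γ) * x (Real.log r + s)) (𝓝[>] 0) (𝓝 w₀) := by
    have h1 : Tendsto (fun r => Real.log r + s) (𝓝[>] 0) atBot :=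
      tendsto_atBot_add_const_right _ s Real.tendsto_log_nhdsGT_zero
    have h2 := (hu.comp h1).const_mul (a * Real.exp (γ * s))
    have h3 : a * Real.exp (γ * s) * u₀ = w₀ := by
      rw [hs, mul_div_cancel₀ _ hγ.ne', Real.exp_log (by positivity)]
      field_simp
    rw [h3] at h2
    refine h2.congr' ?_
    filter_upwards [self_mem_nhdsWithin] with r hr
    have hr : 0 < r := hr
    simp only [Function.comp_apply]
    rw [Real.rpow_def_of_pos hr, mul_assoc a, mul_assoc a, ← mul_assoc (Real.exp (γ * s)),
      ← Real.exp_add]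
    congr 3
    ring_nf
  rcases hsys.global_dichotomy hθ hτ hm hq hmq hγ hδ hδm hγq ha hb hγa hδb with
    h | ⟨w₁, F₀, hw₁, hF₀, hlim, hF, hinf⟩
  · exfalso
    -- At radius `e^(-s)` the shifted orbit is at time `0`, so being self-similar would give `x 0 =
    -- 1`.
    have h1 := h (Real.exp (-s)) (Real.exp_pos _)
    rw [Real.log_exp, neg_add_cancel] at h1
    exact hx1 (mul_left_cancel₀ (by positivity) (h1.trans (mul_one _).symm))
  · exact ⟨_, _, F₀, hsys, hF₀, hw, hF, hinf⟩

end

/-- Global solutions when `ε = -1`. -/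
theorem global_classification {N p q σ : ℝ} (hp : 1 < p) (hq : p - 1 < q) (hNp : N < p)
    (hσN : -σ < N) :
    IsPositiveSolution N p q σ (-1) (Ioi 0) (wStar N p q σ (-1)) ∧
    (∃ c : ℝ → ℝ, (∀ x : ℝ, 0 < x → 0 < c x) ∧
      (∀ w₀ : ℝ, 0 < w₀ → ∃ w : ℝ → ℝ,
        IsC0Regular N p q σ (-1) (Ioi 0) w ∧
        FluxAtZero N p w₀ (-c w₀) w ∧ w ~[atTop] wStar N p q σ (-1)) ∧
      (∀ w : ℝ → ℝ, IsPositiveSolution N p q σ (-1) (Ioi 0) w →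
        (∀ r : ℝ, 0 < r → w r = wStar N p q σ (-1) r) ∨
        (∃ w₀ : ℝ, 0 < w₀ ∧ FluxAtZero N p w₀ (-c w₀) w ∧
          w ~[atTop] wStar N p q σ (-1)))) := by
  have hp1 : 0 < p - 1 := by linarith
  have hq0 : 0 < q := by linarith
  have hqp : 0 < q - p + 1 := by linarith
  have hqp' : 0 < q + 1 - p := by linarith
  have hτ : 0 < N + σ := by linarith
  have hθ : 0 < (p - N) / (p - 1) := div_pos (by linarith) hp1
  have hm : 0 < 1 / (p - 1) := by positivity
  have hmq : 1 < 1 / (p - 1) * q := by rw [one_div_mul_eq_div, one_lt_div hp1]; exact hq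
  set γ := gammaExp p q σ with hγdef
  have hγ : 0 < γ := div_pos (by linarith) hqp'
  -- `δ` is the decay exponent of the flux of `w*`. The relations `γ a = b^m` and `δ b = a^q`
  -- normalize the equilibrium to `(1,1)`, and eliminating `b` gives the defining equation of `a*`.
  set δ := (p - 1) * γ + (p - N) with hδdef
  have hδ : 0 < δ := by have := mul_pos hp1 hγ; linarith
  set a := aStar N p q σ (-1) with hadef
  have haeq : a = (γ ^ (p - 1) * δ) ^ (1 / (q - p + 1)) := by
    rw [hadef, aStar, ← hγdef, abs_of_pos hγ]
    congr 1
    rw [show p - 1 = (p - 2) + 1 by ring, Real.rpow_add_one hγ.ne', hδdef]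
    ring
  have ha : 0 < a := by rw [haeq]; positivity
  set b := (γ * a) ^ (p - 1) with hbdef
  have hb : 0 < b := by positivity
  have hγa : γ * a = b ^ (1 / (p - 1)) := by
    rw [hbdef, ← Real.rpow_mul (by positivity), mul_one_div_cancel hp1.ne', Real.rpow_one]
  have hδb : δ * b = a ^ q := by
    have h1 : a ^ (q - p + 1) = γ ^ (p - 1) * δ := by
      rw [haeq, ← Real.rpow_mul (by positivity), one_div_mul_cancel hqp.ne', Real.rpow_one]
    rw [hbdef, Real.mul_rpow hγ.le ha.le, show q = (q - p + 1) + (p - 1) by ring,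
      Real.rpow_add ha, h1]
    ring
  have hδm : δ * (1 / (p - 1)) = γ + (p - N) / (p - 1) := by
    rw [hδdef]; field_simp
  have hγq : γ * q = δ + (N + σ) := by
    have : γ * (q + 1 - p) = p + σ := div_mul_cancel₀ _ hqp'.ne'
    rw [hδdef]; linear_combination this
  have hc := fun (w₀ : ℝ) (hw₀ : 0 < w₀) => exists_global_solution hθ hτ hm hq0 hmq hγ hδ hδm hγq
    ha hb hγa hδb hw₀
  -- One global solution is selected for each `w₀`, and its flux limit `Φ w₀` defines `c(w₀) = (-Φ
  -- w₀)^(1/(p-1))`.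
  choose! W G Φ hsys hΦ hW hG hinf using hc
  have hspow : ∀ w₀, 0 < w₀ → spow (1 / (p - 1)) (Φ w₀) = -(-Φ w₀) ^ (1 / (p - 1)) :=
    fun w₀ hw₀ => spow_of_neg (hΦ w₀ hw₀)
  have hsub : Ioo (0 : ℝ) 1 ⊆ Ioi 0 := Ioo_subset_Ioi_self
  refine ⟨?_, fun w₀ => (-Φ w₀) ^ (1 / (p - 1)), fun w₀ hw₀ => ?_, fun w₀ hw₀ => ?_,
    fun w hw => ?_⟩
  · have h1 : IsOrbit γ δ (1 / (p - 1)) q (fun _ => 1) (fun _ => 1) := fun t =>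
      ⟨one_pos, one_pos, by simpa using hasDerivAt_const t (1 : ℝ),
        by simpa using hasDerivAt_const t (1 : ℝ)⟩
    have h2 := (h1.isFluxSystem hδm hγq ha hb hγa hδb).isPositiveSolution hp subset_rfl isOpen_Ioi
    simp only [mul_one] at h2
    exact h2
  · exact Real.rpow_pos_of_pos (neg_pos.2 (hΦ w₀ hw₀)) _
  · refine ⟨W w₀, (hsys w₀ hw₀).isC0Regular hp subset_rfl isOpen_Ioi
      (fun r hr => ((hsys w₀ hw₀).flux_neg hθ hτ hm hq0 hmq hr).ne) hw₀.le (hW w₀ hw₀), ?_,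
      isEquivalent_of_tendsto_one (hinf w₀ hw₀)⟩
    rw [← hspow w₀ hw₀]
    exact ((hsys w₀ hw₀).mono hsub).fluxAtZero hp one_pos (hW w₀ hw₀) (hG w₀ hw₀)
  · have hF := hw.isFluxSystem hp subset_rfl
    rcases hF.global_dichotomy hθ hτ hm hq0 hmq hγ hδ hδm hγq ha hb hγa hδb with
      h | ⟨w₀, F₀, hw₀, hF₀, hlim, hFlim, hwinf⟩
    · exact Or.inl h
    · refine Or.inr ⟨w₀, hw₀, ?_, isEquivalent_of_tendsto_one hwinf⟩
      -- Comparison in both directions shows that the flux limit depends on `w₀` alone, not on the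
      -- selected solution.
      have heq : F₀ = Φ w₀ := le_antisymm
        ((hsys w₀ hw₀).flux_limit_le hθ hτ hm hq0 hmq hF (hW w₀ hw₀) hlim (hG w₀ hw₀) hFlim)
        (hF.flux_limit_le hθ hτ hm hq0 hmq (hsys w₀ hw₀) hlim (hW w₀ hw₀) hFlim (hG w₀ hw₀))
      rw [← hspow w₀ hw₀, ← heq]
      exact (hF.mono hsub).fluxAtZero hp one_pos hlim hFlim

end HardyHenon

theorem theorem4 (N p q σ : ℝ) (hp : 1 < p) (hq : p - 1 < q) (hNp : N < p) (hσN : -σ < N) :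
    -- the three types of local `C^0`-regular solutions near `0`, for `ε = 1` and `ε = -1`
    (∃ c₁ c₂ : ℝ → ℝ, (∀ x : ℝ, 0 < x → 0 < c₁ x ∧ 0 < c₂ x) ∧
      ∀ ε : ℝ, (ε = 1 ∨ ε = -1) →
        (∀ w₀ : ℝ, 0 < w₀ → ∃ ρ : ℝ, 0 < ρ ∧ ∃ w : ℝ → ℝ,
          HardyHenon.IsC0Regular N p q σ ε (Ioo 0 ρ) w ∧
          HardyHenon.RegularAtZero p σ w₀ (-ε * c₁ w₀) w) ∧
        (∀ k : ℝ, 0 < k → ∃ ρ : ℝ, 0 < ρ ∧ ∃ w : ℝ → ℝ,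
          HardyHenon.IsC0Regular N p q σ ε (Ioo 0 ρ) w ∧
          HardyHenon.VanishingAtZero N p k (c₂ k) w) ∧
        (∀ w₀ d : ℝ, 0 < w₀ → d ≠ 0 → ∃ ρ : ℝ, 0 < ρ ∧ ∃ w : ℝ → ℝ,
          HardyHenon.IsC0Regular N p q σ ε (Ioo 0 ρ) w ∧
          HardyHenon.FluxAtZero N p w₀ d w) ∧
        (∀ (ρ : ℝ) (w : ℝ → ℝ), 0 < ρ → HardyHenon.IsC0Regular N p q σ ε (Ioo 0 ρ) w →
          (∃ w₀ : ℝ, 0 < w₀ ∧ HardyHenon.RegularAtZero p σ w₀ (-ε * c₁ w₀) w) ∨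
          (∃ k : ℝ, 0 < k ∧ HardyHenon.VanishingAtZero N p k (c₂ k) w) ∨
          (∃ w₀ d : ℝ, 0 < w₀ ∧ d ≠ 0 ∧ HardyHenon.FluxAtZero N p w₀ d w))) ∧
    -- `ε = 1`: no solution on `(r₀, ∞)`; `r₀ = 0` says that no solution is global
    (∀ r₀ : ℝ, 0 ≤ r₀ → ¬ ∃ w : ℝ → ℝ, HardyHenon.IsPositiveSolution N p q σ 1 (Ioi r₀) w) ∧
    -- `ε = -1`: the global solutions on `(0, ∞)`
    HardyHenon.IsPositiveSolution N p q σ (-1) (Ioi 0) (HardyHenon.wStar N p q σ (-1)) ∧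
    (∃ c : ℝ → ℝ, (∀ x : ℝ, 0 < x → 0 < c x) ∧
      (∀ w₀ : ℝ, 0 < w₀ → ∃ w : ℝ → ℝ,
        HardyHenon.IsC0Regular N p q σ (-1) (Ioi 0) w ∧
        HardyHenon.FluxAtZero N p w₀ (-c w₀) w ∧
        w ~[atTop] HardyHenon.wStar N p q σ (-1)) ∧
      (∀ w : ℝ → ℝ, HardyHenon.IsPositiveSolution N p q σ (-1) (Ioi 0) w →
        (∀ r : ℝ, 0 < r → w r = HardyHenon.wStar N p q σ (-1) r) ∨
        (∃ w₀ : ℝ, 0 < w₀ ∧ HardyHenon.FluxAtZero N p w₀ (-c w₀) w ∧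
          w ~[atTop] HardyHenon.wStar N p q σ (-1)))) := by
  have hp1 : 0 < p - 1 := by linarith
  refine ⟨HardyHenon.local_classification hp hq hNp hσN, fun r₀ hr₀ => ?_,
    HardyHenon.global_classification hp hq hNp hσN⟩
  rintro ⟨w, hw⟩
  exact (hw.isFluxSystem hp fun r hr => hr₀.trans_lt hr).not_exterior
    (div_pos (by linarith) hp1) (by linarith) (by positivity) (by linarith) hr₀
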